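/- **Setting.** Let $(M,\omega)$ be a compact simply connected symplectic manifold of dimension $2n$, and let $L\to M$ be a smooth hermitian complex line bundle with a hermitian connection $\nabla$ whose curvature is $2\pi i\,\omega$ (a prequantization connection). Let $\Gamma(M,L)$ be the Fréchet space of smooth sections and $\mathbb P\Gamma(M,L)$ its projectivization, with $T_p\mathbb P\Gamma(M,L)=\mathrm{Hom}_{\mathbb C}(p,\Gamma(M,L)/p)$. For $F\in C^\infty(M,\mathbb R)$ put $P(F)[\alpha]=[e^{iF}\alpha]$, and let $\Theta_P(F)$ be the vector field on $\mathbb P\Gamma(M,L)$ generated by the one-parameter group $P(tF)$; at $[\alpha]$ it sends $\alpha$ to the class of $iF\alpha$. Let $\mathcal D_p\subset T_p\mathbb P\Gamma(M,L)$ be the real span of the vectors $\Theta_P(F)(p)$. An *integral manifold* of $\mathcal D$ is the image of a smooth map from $C^\infty(M,\mathbb R)$ to $\mathbb P\Gamma(M,L)$ whose differential at every point has image $\mathcal D$. A *leaf* is a nonempty integral manifold which, for each of its points, is the set of all points that can be reached from it along smooth curves $\gamma$ with $\dot\gamma(t)=\Theta_P(F_t)(\gamma(t))$, $F_t\in C^\infty(M,\mathbb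 R)$ depending smoothly on $t$. Two nonzero sections $\alpha,\beta$ have the same zero divisor, $(\alpha)_0=(\beta)_0$, if near every point of $M$ either $\beta=u\alpha$ with $u$ a smooth complex function without zeros, or the point is a regular (transversal) zero of both, $\alpha$ and $\beta$ have the same zeros near it, and they induce the same orientation of the normal bundle of this zero set. For a zero divisor $D$ with support $|D|$ (the common zero set) put $\mathbb P(D)=\{[\alpha]: (\alpha)_0=D\}$. For $[\alpha]\in\mathbb P(D)$ let $\rho(\alpha)=\nabla\alpha/\alpha$, a complex one-form on $M\setminus|D|$. Let $\mathbb P^0(D)$ denote any nonempty fiber of the map $[\alpha]\mapsto\mathrm{Re}\,\rho(\alpha)$ on $\mathbb P(D)$. **Proposition 3.** (1) The distribution $\mathcal D$ is integrable: every point of $\mathbb P\Gamma(M,L)$ lies on a leaf. (2) For every zero divisor $D$ whose support has empty interior, every $\mathbb P^0(D)$ is a leaf. Conversely, if a leaf contains a point $[\alpha]$ such that the zero set of $\alpha$ has empty interior, then it is the space $\mathbb P^0(D)$ through $[\alpha]$, where $D=(\alpha)_0$. (3) $\rho(e^{iF}\alpha)=\rho(\alpha)+i\,dF$ where $\alpha\neq0$.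 If the support of $D$ has empty interior, each $\mathbb P^0(D)$ is a real affine space over the vector space of exact real one-forms $dF$, $F\in C^\infty(M,\mathbb R)$, with $dF$ acting as the translation $P(F)$; and, at each of its points, $\Theta_P(F)=\Theta_P(G)$ if and only if $dF=dG$. -/

import Mathlib

open scoped Manifold ContDiff Topology LinearAlgebra.Projectivization
open Bundle

namespace PhaseChange

noncomputable section

section Symplectic

variable {E : Type*} [NormedAddCommGroup E] [NormedSpace ℝ E]
  {H : Type*} [TopologicalSpace H] (I : ModelWithCorners ℝ E H)
  (M : Type*) [TopologicalSpace M] [ChartedSpace H M] [IsManifold I ∞ M]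

variable {M} in
/-- Smoothness of a vector field on `M`. -/
def IsSmoothField (X : ∀ x : M, TangentSpace I x) : Prop :=
  ContMDiff I I.tangent ∞ (fun x => (⟨x, X x⟩ : TangentBundle I M))

/-- A symplectic form: a smooth, closed, nondegenerate alternating two-form.
Closedness is written with the invariant formula for the exterior derivative. -/
structure SymplecticForm where
  form : ∀ x : M, TangentSpace I x →L[ℝ] TangentSpace I x →L[ℝ] ℝ
  alternating : ∀ (x : M) (v : TangentSpace I x), form x v v = 0
  nondegenerate : ∀ (x : M) (v : TangentSpace I x), (∀ w, form x v w = 0) → v = 0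
  smooth : ∀ X Y : ∀ x : M, TangentSpace I x, IsSmoothField I X → IsSmoothField I Y →
    ContMDiff I 𝓘(ℝ, ℝ) ∞ (fun x => form x (X x) (Y x))
  closed : ∀ X Y Z : ∀ x : M, TangentSpace I x,
    IsSmoothField I X → IsSmoothField I Y → IsSmoothField I Z → ∀ x : M,
      mvfderiv I (fun y => form y (Y y) (Z y)) x (X x)
      + mvfderiv I (fun y => form y (Z y) (X y)) x (Y x)
      + mvfderiv I (fun y => form y (X y) (Y y)) x (Z x)
      - form x (VectorField.mlieBracket I X Y x) (Z x)
      - form x (VectorField.mlieBracket I Y Z x) (X x)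
      - form x (VectorField.mlieBracket I Z X x) (Y x) = 0

end Symplectic

section LineBundle

variable {E : Type*} [NormedAddCommGroup E] [NormedSpace ℝ E]
  {H : Type*} [TopologicalSpace H] (I : ModelWithCorners ℝ E H)
  {M : Type*} [TopologicalSpace M] [ChartedSpace H M]
  (L : M → Type*) [∀ x, NormedAddCommGroup (L x)] [∀ x, InnerProductSpace ℂ (L x)]
  [TopologicalSpace (TotalSpace ℂ L)] [FiberBundle ℂ L]

variable {L} in
/-- Smoothness of a section of the line bundle `L`. -/
def IsSmoothSection (s : ∀ x, L x) : Prop :=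
  ContMDiff I (I.prod 𝓘(ℝ, ℂ)) ∞ (fun x => TotalSpace.mk' ℂ x (s x))

/-- The hermitian products of the fibers depend smoothly on the point.
The product `inner ℂ` is conjugate linear in its first argument. -/
def IsSmoothHermitian : Prop :=
  ∀ s t : ∀ x, L x, IsSmoothSection I s → IsSmoothSection I t →
    ContMDiff I 𝓘(ℝ, ℂ) ∞ (fun x => inner ℂ (s x) (t x))

variable {L}

variable {I} in
/-- The (smooth, complex linear) connection `a` on `L` preserves the hermitian structure. Here
`a s x v` is `(∇_v s)(x)`. -/
structure IsHermitianConnection [IsManifold I ∞ M] (a : CovariantDerivative I ℂ L) : Prop where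
  smooth : ∀ (s : ∀ x, L x) (X : ∀ x : M, TangentSpace I x), IsSmoothSection I s →
    IsSmoothField I X → IsSmoothSection I (fun x => a s x (X x))
  complex_linear : ∀ (c : ℂ) (s : ∀ x, L x), IsSmoothSection I s →
    ∀ (x : M) (v : TangentSpace I x), a (c • s) x v = c • a s x v
  hermitian : ∀ s t : ∀ x, L x, IsSmoothSection I s → IsSmoothSection I t →
    ∀ (x : M) (v : TangentSpace I x), mvfderiv I (fun y => inner ℂ (s y) (t y)) x v =
      inner ℂ (a s x v) (t x) + inner ℂ (s x) (a t x v)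

variable {I} in
/-- The prequantization connections `𝒪(Ω)`: hermitian connections whose curvature
`[∇_X, ∇_Y] - ∇_[X,Y]` is multiplication by `2πi Ω(X, Y)`, that is, whose real curvature form
is `2πΩ`. -/
structure IsPrequantumConnection [IsManifold I ∞ M] (Ω : SymplecticForm I M)
    (a : CovariantDerivative I ℂ L) : Prop extends IsHermitianConnection a where
  curvature : ∀ (X Y : ∀ x : M, TangentSpace I x) (s : ∀ x, L x),
    IsSmoothField I X → IsSmoothField I Y → IsSmoothSection I s → ∀ x : M,
      a (fun y => a s y (Y y)) x (X x) - a (fun y => a s y (X y)) x (Y x)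
        - a s x (VectorField.mlieBracket I X Y x)
      = (2 * (Real.pi : ℂ) * Complex.I * ((Ω.form x (X x) (Y x) : ℝ) : ℂ)) • s x

variable [VectorBundle ℂ ℂ L]

theorem isSmoothSection_smul {u : M → ℂ} {s : ∀ x, L x} (hu : ContMDiff I 𝓘(ℝ, ℂ) ∞ u)
    (hs : IsSmoothSection I s) : IsSmoothSection I (fun x => u x • s x) := by
  intro x₀
  rw [contMDiffAt_section]
  have h := (contMDiffAt_section x₀).1 (hs x₀)
  have hmul := (contDiff_mul (𝕜 := ℝ) (𝔸 := ℂ) (n := ∞)).contMDiff.contMDiffAt.comp x₀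
    ((hu x₀).prodMk_space h)
  refine hmul.congr_of_eventuallyEq ?_
  filter_upwards [(trivializationAt ℂ L x₀).open_baseSet.mem_nhds
    (mem_baseSet_trivializationAt ℂ L x₀)] with x hx
  exact ((trivializationAt ℂ L x₀).linear ℂ hx).2 (u x) (s x)

variable [VectorBundle ℝ ℂ L]

variable (L) in
/-- The complex vector space `Γ(M, L)` of smooth sections of `L`. -/
def Γ : Submodule ℂ (∀ x, L x) where
  carrier := {s | IsSmoothSection I s}
  add_mem' hs ht := ContMDiff.add_section hs ht
  zero_mem' := contMDiff_zeroSection ℝ L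
  smul_mem' c _ hs := isSmoothSection_smul I (u := fun _ => c) contMDiff_const hs

variable (L) in
/-- The projective space `ℙ Γ(M, L)`. -/
abbrev PΓ : Type _ := ℙ ℂ (Γ I L)

/-- Multiplication of smooth sections by a smooth complex function. -/
def mulFn (u : C^∞⟮I, M; 𝓘(ℝ, ℂ), ℂ⟯) : Γ I L →ₗ[ℂ] Γ I L where
  toFun s := ⟨fun x => u x • s.1 x, isSmoothSection_smul I u.contMDiff s.2⟩
  map_add' s t := by ext x; exact smul_add (u x) (s.1 x) (t.1 x)
  map_smul' c s := by ext x; exact smul_comm (u x) c (s.1 x)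

/-- The smooth function `i F`. -/
def iFn (F : C^∞⟮I, M; 𝓘(ℝ, ℝ), ℝ⟯) : C^∞⟮I, M; 𝓘(ℝ, ℂ), ℂ⟯ :=
  ⟨fun x => Complex.I * (F x : ℂ),
    (contDiff_const.mul Complex.ofRealCLM.contDiff).contMDiff.comp F.contMDiff⟩

/-- The smooth function `e^{i F}`. -/
def phaseFn (F : C^∞⟮I, M; 𝓘(ℝ, ℝ), ℝ⟯) : C^∞⟮I, M; 𝓘(ℝ, ℂ), ℂ⟯ :=
  ⟨fun x => Complex.exp (Complex.I * (F x : ℂ)),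
    (Complex.contDiff_exp (𝕜 := ℝ)).contMDiff.comp (iFn I F).contMDiff⟩

theorem mulFn_phaseFn_injective (F : C^∞⟮I, M; 𝓘(ℝ, ℝ), ℝ⟯) :
    Function.Injective (mulFn I (phaseFn I F) : Γ I L →ₗ[ℂ] Γ I L) := by
  intro s t h
  ext x
  have hx : Complex.exp (Complex.I * (F x : ℂ)) • s.1 x
      = Complex.exp (Complex.I * (F x : ℂ)) • t.1 x := congrFun (congrArg Subtype.val h) x
  exact smul_right_injective _ (Complex.exp_ne_zero _) hx

/-- The phase changing transformation `P(F) : [α] ↦ [e^{i F} α]`. -/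
def P (F : C^∞⟮I, M; 𝓘(ℝ, ℝ), ℝ⟯) : PΓ I L → PΓ I L :=
  Projectivization.map (mulFn I (phaseFn I F)) (mulFn_phaseFn_injective I F)

/-! ### Smooth curves, velocities and the phase changing distribution

The spaces `Γ(M, L)` and `C^∞(M, ℝ)` are Fréchet spaces; a curve in one of them is smooth exactly
when it is a jointly smooth function of the parameter and of the point of `M`. -/

variable {I} in
/-- A smooth curve in `Γ(M, L)`. -/
def IsSmoothCurveΓ (A : ℝ → Γ I L) : Prop :=
  ContMDiff (𝓘(ℝ, ℝ).prod I) (I.prod 𝓘(ℝ, ℂ)) ∞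
    (fun q : ℝ × M => TotalSpace.mk' ℂ q.2 ((A q.1).1 q.2))

variable {I} in
/-- A smooth curve in `C^∞(M, ℝ)`. -/
def IsSmoothCurveFn (F : ℝ → C^∞⟮I, M; 𝓘(ℝ, ℝ), ℝ⟯) : Prop :=
  ContMDiff (𝓘(ℝ, ℝ).prod I) 𝓘(ℝ, ℝ) ∞ (fun q : ℝ × M => F q.1 q.2)

variable {I} in
/-- `A` is a smooth curve of nonzero sections that lifts the curve `γ` in `ℙ Γ(M, L)`. -/
def IsSmoothLift (γ : ℝ → PΓ I L) (A : ℝ → Γ I L) : Prop :=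
  IsSmoothCurveΓ A ∧ ∀ s, ∃ h : A s ≠ 0, γ s = Projectivization.mk ℂ (A s) h

variable {I} in
/-- The tangent space of `ℙ Γ(M, L)` at `p`, that is `Hom(p, Γ(M, L) / p)`. -/
abbrev TangentPΓ (p : PΓ I L) : Type _ :=
  p.submodule →ₗ[ℂ] (Γ I L ⧸ p.submodule)

variable {I} in
/-- The smooth curve `γ` in `ℙ Γ(M, L)` passes through `p` at time `t` with velocity `ξ`:
if `A` is a smooth lift, `ξ` sends `A t` to the class of the derivative of `A` at `t`. -/
def HasVelocity (γ : ℝ → PΓ I L) (t : ℝ) (p : PΓ I L) (ξ : TangentPΓ p) : Prop :=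
  γ t = p ∧ ∃ A : ℝ → Γ I L, IsSmoothLift γ A ∧ ∃ B : Γ I L,
    (∀ x, HasDerivAt (fun s => (A s).1 x) (B.1 x) t) ∧
    ∀ v : p.submodule, (v : Γ I L) = A t → ξ v = p.submodule.mkQ B

/-- The infinitesimal phase change `Θ_P(F)`, the vector field on `ℙ Γ(M, L)` whose value at the
line `p` sends `α ∈ p` to the class of `i F α`. -/
def ΘP (F : C^∞⟮I, M; 𝓘(ℝ, ℝ), ℝ⟯) (p : PΓ I L) : TangentPΓ p :=
  p.submodule.mkQ ∘ₗ mulFn I (iFn I F) ∘ₗ p.submodule.subtype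

variable {I} in
/-- The distribution on `ℙ Γ(M, L)` spanned by the vector fields `Θ_P(F)`. -/
def phaseDistribution (p : PΓ I L) : Submodule ℝ (TangentPΓ p) :=
  Submodule.span ℝ (Set.range fun F : C^∞⟮I, M; 𝓘(ℝ, ℝ), ℝ⟯ => ΘP I F p)

variable {I} in
/-- `N` is an integral manifold of the distribution: it is the image of a smooth map `φ` (one that
sends smooth curves to smooth curves) defined on the vector space `C^∞(M, ℝ)` whose
differential at every point has the distribution as its image. -/
def IsIntegralManifold (N : Set (PΓ I L)) : Prop :=
  ∃ φ : C^∞⟮I, M; 𝓘(ℝ, ℝ), ℝ⟯ → PΓ I L, Set.range φ = N ∧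
    (∀ c, IsSmoothCurveFn c → ∃ A, IsSmoothLift (fun t => φ (c t)) A) ∧
    ∀ (F : C^∞⟮I, M; 𝓘(ℝ, ℝ), ℝ⟯) (ξ : TangentPΓ (φ F)),
      ξ ∈ phaseDistribution (φ F) ↔
        ∃ c, IsSmoothCurveFn c ∧ c 0 = F ∧ HasVelocity (fun t => φ (c t)) 0 (φ F) ξ

variable {I} in
/-- The points that can be reached from `p` along curves tangent to the distribution, the velocity
at time `t` being `Θ_P(F_t)` with `F_t` depending smoothly on `t`. -/
def reachable (p : PΓ I L) : Set (PΓ I L) :=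
  {q | ∃ (γ : ℝ → PΓ I L) (F : ℝ → C^∞⟮I, M; 𝓘(ℝ, ℝ), ℝ⟯), IsSmoothCurveFn F ∧
    γ 0 = p ∧ γ 1 = q ∧ ∀ t ∈ Set.Icc (0 : ℝ) 1, HasVelocity γ t (γ t) (ΘP I (F t) (γ t))}

variable {I} in
/-- A leaf of the distribution: a nonempty integral manifold which is, for each of its points, the
set of all points that can be reached from it along curves tangent to the distribution. -/
def IsLeaf (N : Set (PΓ I L)) : Prop :=
  N.Nonempty ∧ IsIntegralManifold N ∧ ∀ p ∈ N, reachable p = N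

/-! ### Zero divisors and the form `ρ(α)` -/

/-- Two complex functions define the same zero divisor near `p`: either they differ by a smooth
factor without zeros, or `p` is a regular zero of both, they have the same zeros near `p`, and
they define the same orientation of the normal bundle of their common zero set. -/
def SameZerosAt (p : M) (f g : M → ℂ) : Prop :=
  (∃ (U : Set M) (u : M → ℂ), IsOpen U ∧ p ∈ U ∧ ContMDiffOn I 𝓘(ℝ, ℂ) ∞ u U ∧
    ∀ x ∈ U, u x ≠ 0 ∧ f x = u x * g x) ∨
  (∃ U : Set M, IsOpen U ∧ p ∈ U ∧ ContMDiffOn I 𝓘(ℝ, ℂ) ∞ f U ∧ ContMDiffOn I 𝓘(ℝ, ℂ) ∞ g U ∧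
    f p = 0 ∧ (∀ x ∈ U, f x = 0 ↔ g x = 0) ∧
    Function.Surjective (mvfderiv I f p) ∧ Function.Surjective (mvfderiv I g p) ∧
    ∃ T : ℂ →ₗ[ℝ] ℂ, 0 < LinearMap.det T ∧ ∀ v, mvfderiv I f p v = T (mvfderiv I g p v))

variable {I} in
/-- The section `α` in the preferred trivialization of `L` near `p`. -/
def localFn (α : Γ I L) (p : M) : M → ℂ :=
  fun x => (trivializationAt ℂ L p ⟨x, α.1 x⟩).2

variable {I} in
/-- The zero divisor `(α)_0` (zeros with multiplicities), given as the family of the sets of its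
local equations at the points of `M`. -/
def zeroDivisor (α : Γ I L) : M → Set (M → ℂ) :=
  fun p => {f | SameZerosAt I p f (localFn α p)}

/-- The support `|D|` of a divisor given by its local equations. -/
def divisorSupport (D : M → Set (M → ℂ)) : Set M :=
  {x | ∀ f ∈ D x, f x = 0}

variable {I} in
/-- The complex one-form `ρ(α) = ∇α / α`. The quotient of `t` by `s ≠ 0` in a complex line is
`⟨s, t⟩ / ⟨s, s⟩`; the value at a zero of `α` is irrelevant. -/
def rho (a : CovariantDerivative I ℂ L) (α : Γ I L) (x : M) : TangentSpace I x →L[ℝ] ℂ :=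
  (((inner ℂ (α.1 x) (α.1 x))⁻¹ • innerSL ℂ (α.1 x)).restrictScalars ℝ).comp (a α.1 x)

variable {I} in
/-- The real one-form `Re ρ(α)`. -/
def reRho (a : CovariantDerivative I ℂ L) (α : Γ I L) (x : M) : TangentSpace I x →L[ℝ] ℝ :=
  Complex.reCLM.comp (rho a α x)

variable (L) in
/-- `ℙ(D)`, the set of the classes `[α]` with `(α)_0 = D`. -/
def PD (D : M → Set (M → ℂ)) : Set (PΓ I L) :=
  {p | ∃ (α : Γ I L) (hα : α ≠ 0), p = Projectivization.mk ℂ α hα ∧ zeroDivisor α = D}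

variable {I} in
/-- `ℙ⁰(D)`, the fiber of `[α] ↦ Re ρ(α)`, as a map from `ℙ(D)` to one-forms on `M \ |D|`, over the
restriction of `η` to `M \ |D|`. (The form `ρ(α)` depends only on the class `[α]`.) -/
def PD0 (a : CovariantDerivative I ℂ L) (D : M → Set (M → ℂ))
    (η : ∀ x : M, TangentSpace I x →L[ℝ] ℝ) : Set (PΓ I L) :=
  {p | p ∈ PD I L D ∧ ∀ (α : Γ I L) (hα : α ≠ 0), p = Projectivization.mk ℂ α hα →
    ∀ x, x ∉ divisorSupport D → reRho a α x = η x}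

end LineBundle

section ExactForms

variable {E : Type*} [NormedAddCommGroup E] [NormedSpace ℝ E]
  {H : Type*} [TopologicalSpace H] (I : ModelWithCorners ℝ E H)
  (M : Type*) [TopologicalSpace M] [ChartedSpace H M]

/-- The differential `F ↦ dF` on smooth real functions. -/
def dFn : C^∞⟮I, M; 𝓘(ℝ, ℝ), ℝ⟯ →ₗ[ℝ] (∀ x : M, TangentSpace I x →L[ℝ] ℝ) where
  toFun F x := mvfderiv I F x
  map_add' F G := by
    funext x
    exact mvfderiv_add (F.contMDiff.mdifferentiable (by simp) x)
      (G.contMDiff.mdifferentiable (by simp) x)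
  map_smul' c F := by
    funext x
    have h := mvfderiv_smul (I := I) (a := fun _ : M => c) (x := x) mdifferentiableAt_const
      (F.contMDiff.mdifferentiable (by simp) x)
    have h2 : mvfderiv I (⇑(c • F)) x = mvfderiv I ((fun _ : M => c) • ⇑F) x := rfl
    rw [h2, h]
    ext v
    simp [mvfderiv_const]

/-- The real vector space of exact real one-forms on `M`. -/
def ExactForms : Submodule ℝ (∀ x : M, TangentSpace I x →L[ℝ] ℝ) :=
  LinearMap.range (dFn I M)

variable {I M}

/-- The set `N` of points of `ℙ Γ(M, L)` is an affine space over the real vector space of exact real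
one-forms on `M`, on which `dF` acts as the translation `P(F)`. -/
def IsAffineOverExactForms {L : M → Type*} [∀ x, NormedAddCommGroup (L x)]
    [∀ x, InnerProductSpace ℂ (L x)] [TopologicalSpace (TotalSpace ℂ L)] [FiberBundle ℂ L]
    [VectorBundle ℂ ℂ L] [VectorBundle ℝ ℂ L] (N : Set (PΓ I L)) : Prop :=
  ∃ A : AddTorsor (ExactForms I M) N, ∀ (F : C^∞⟮I, M; 𝓘(ℝ, ℝ), ℝ⟯) (p : N),
    (A.vadd ⟨dFn I M F, LinearMap.mem_range_self _ F⟩ p : PΓ I L) = P I F p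

end ExactForms

end

end PhaseChange

open PhaseChange

/-! The leaves are the orbits of the additive group of smooth real functions, acting on `PΓ` by `P`
(`phaseOrbit`). The orbit map F ↦ P(F)p parametrizes an integral manifold, because the curve P(F_t)p
has velocity Θ_P(dF_t/dt) and F ↦ Θ_P(F) is linear. Nothing outside the orbit can be reached: a lift
A of an admissible curve satisfies A' = (iF_t + μ_t)A with a scalar μ_t that does not depend on the
point of M, so A_1 is a constant times e^{i∫F_t} A_0 (`reachable_subset_phaseOrbit`).

It remains to see that ℙ⁰(D) is one orbit (`PD0_eq_phaseOrbit`). Phase changes preserve the divisor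
and add only i dF to ρ. Conversely, let α and β have the same divisor and the same Re ρ. Since ∇ is
hermitian, d|α|² = 2|α|² Re ρ(α), so |β|/|α| is locally constant off the zeros.

The main point is that β/α extends across the zeros to a smooth function without zeros. At a regular
zero, the local equation of α is taken as a coordinate z. The local equation f of β then satisfies
|f| = c|z|, and equality of orientations gives ∂f/∂z ≠ 0 at the zero. Hadamard's lemma writes f = zH
+ z̄k with H ≠ 0 nearby; together with f f̄ = c² z z̄ this yields f z̄ = zG with G smooth, which
forces z to divide f (`exists_eq_fst_mul_of_mul_conj`).

Hence β = uα globally. The differential of |u|² vanishes on the dense complement of the zeros, so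
|u| is a constant c, and simple connectedness gives u = c e^{iF} (`exists_phase`). The affine
structure uses density once more: a phase that is constant off the zeros is constant, so P(F) fixes
a point of ℙ⁰(D) exactly when dF = 0. -/

/-! ### Smoothness of integrals depending on a parameter. -/

section ParametricIntegral

open MeasureTheory Set

variable {E : Type*} [NormedAddCommGroup E] [NormedSpace ℝ E]
  {F : Type*} [NormedAddCommGroup F] [NormedSpace ℝ F]

/-- The integral is a convolution with parameter, evaluated at 0: the indicator of [0, 1] against
the integrand, reflected and cut off near [0, 1]. -/
theorem contDiffAt_nat_intervalIntegral (n : ℕ) {g : E × ℝ → F} {p : E}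
    (hg : ∀ t ∈ Icc (0 : ℝ) 1, ContDiffAt ℝ n g (p, t)) :
    ContDiffAt ℝ n (fun q => ∫ t in (0 : ℝ)..1, g (q, t)) p := by
  have hW : IsOpen (interior {z : E × ℝ | ContDiffAt ℝ n g z}) := isOpen_interior
  have hsub : ({p} : Set E) ×ˢ Icc (0 : ℝ) 1 ⊆ interior {z : E × ℝ | ContDiffAt ℝ n g z} := by
    rintro ⟨q, t⟩ ⟨rfl, ht⟩
    rw [mem_interior_iff_mem_nhds]
    exact (hg t ht).eventually (by simp)
  obtain ⟨u, v, hu, hv, hpu, hIv, huv⟩ :=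
    generalized_tube_lemma isCompact_singleton isCompact_Icc hW hsub
  -- The cutoff `χ` is 1 on [0, 1] and 0 off `v ∩ (-1, 2)`, so `χ • g` extends by zero beyond the
  -- tube on which `g` is smooth. The bounds -1 and 2 make the support compact; after reflection it
  -- lies in `Icc (-2) 1`.
  have hd : Disjoint (v ∩ Ioo (-1) 2)ᶜ (Icc (0 : ℝ) 1) := by
    rw [disjoint_compl_left_iff_subset]
    exact fun t ht => ⟨hIv ht, by linarith [ht.1], by linarith [ht.2]⟩
  obtain ⟨χ, hχ0, hχ1, -⟩ := exists_contMDiffMap_zero_one_nhds_of_isClosed (n := (⊤ : ℕ∞))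
    𝓘(ℝ, ℝ) (hv.inter isOpen_Ioo).isClosed_compl isClosed_Icc hd
  have hχ : ContDiff ℝ n χ := χ.contMDiff.contDiff.of_le (by exact_mod_cast le_top)
  have key := contDiffOn_convolution_right_with_param_comp (μ := volume) (n := n)
    (ContinuousLinearMap.lsmul ℝ ℝ : ℝ →L[ℝ] F →L[ℝ] F) (s := u) (v := fun _ : E => (0 : ℝ))
    (f := indicator (Icc (0 : ℝ) 1) fun _ => (1 : ℝ))
    (g := fun q x => χ (-x) • g (q, -x)) (k := Icc (-2) 1)
    contDiffOn_const hu isCompact_Icc ?_ ?_ ?_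
  · refine (key.contDiffAt (hu.mem_nhds (hpu rfl))).congr_of_eventuallyEq ?_
    filter_upwards with q
    rw [intervalIntegral.integral_of_le zero_le_one, ← integral_Icc_eq_integral_Ioc, convolution,
      ← integral_indicator measurableSet_Icc]
    congr 1
    ext t
    by_cases ht : t ∈ Icc (0 : ℝ) 1
    · have h1 : χ t = 1 := hχ1.self_of_nhdsSet t ht
      simp [indicator_of_mem ht, h1]
    · simp [indicator_of_notMem ht]
  · intro q x _ hx
    have : χ (-x) = 0 := hχ0.self_of_nhdsSet _ fun h => hx ⟨by linarith [h.2.2], by linarith [h.2.1]⟩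
    simp [this]
  · exact ((integrable_indicator_iff measurableSet_Icc).2
      (by simp)).locallyIntegrable
  · rintro ⟨q, x⟩ ⟨hq, -⟩
    refine ContDiffAt.contDiffWithinAt ?_
    by_cases hx : -x ∈ v
    · have h1 : ContDiffAt ℝ n g (q, -x) := interior_subset (huv (Set.mk_mem_prod hq hx))
      exact (hχ.contDiffAt.comp (q, x) contDiffAt_snd.neg).smul
        (ContDiffAt.comp (q, x) h1 (contDiffAt_fst.prodMk contDiffAt_snd.neg))
    · have h0 : ∀ᶠ y in 𝓝 (-x), χ y = 0 :=
        eventually_nhdsSet_iff_forall.1 hχ0 _ fun h => hx h.1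
      have h1 : ∀ᶠ z : E × ℝ in 𝓝 (q, x), χ (-z.2) = 0 :=
        (continuous_snd.neg.tendsto (q, x)).eventually h0
      refine (contDiffAt_const (c := (0 : F))).congr_of_eventuallyEq ?_
      filter_upwards [h1] with z hz
      simp [Function.HasUncurry.uncurry, hz]

theorem contDiffAt_intervalIntegral {g : E × ℝ → F} {p : E}
    (hg : ∀ t ∈ Icc (0 : ℝ) 1, ContDiffAt ℝ ∞ g (p, t)) :
    ContDiffAt ℝ ∞ (fun q => ∫ t in (0 : ℝ)..1, g (q, t)) p :=
  contDiffAt_infty.2 fun n => contDiffAt_nat_intervalIntegral n fun t ht =>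
    contDiffAt_infty.1 (hg t ht) n

end ParametricIntegral

/-! ### Division of smooth functions by a complex coordinate z. -/

section Division

open MeasureTheory Set Metric ComplexConjugate

variable {K : Type*} [NormedAddCommGroup K] [NormedSpace ℝ K]

/-- The Wirtinger derivative `∂/∂z` in the first variable. -/
noncomputable def wirtinger (f : ℂ × K → ℂ) (q : ℂ × K) : ℂ :=
  (fderiv ℝ f q (1, 0) - Complex.I * fderiv ℝ f q (Complex.I, 0)) / 2

/-- The Wirtinger derivative with respect to the conjugate of the first variable. -/
noncomputable def wirtingerBar (f : ℂ × K → ℂ) (q : ℂ × K) : ℂ :=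
  (fderiv ℝ f q (1, 0) + Complex.I * fderiv ℝ f q (Complex.I, 0)) / 2

theorem apply_eq_wirtinger (A : ℂ × K →L[ℝ] ℂ) (w : ℂ) :
    A (w, 0) = w * ((A (1, 0) - Complex.I * A (Complex.I, 0)) / 2)
      + conj w * ((A (1, 0) + Complex.I * A (Complex.I, 0)) / 2) := by
  have h : ((w, 0) : ℂ × K) = w.re • (1, 0) + w.im • (Complex.I, 0) := by
    ext <;> simp
  rw [h, map_add, map_smul, map_smul, Complex.real_smul, Complex.real_smul]
  conv_rhs => rw [← Complex.re_add_im w]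
  simp only [map_add, map_mul, Complex.conj_ofReal, Complex.conj_I]
  linear_combination ((w.im : ℂ) * A (Complex.I, 0)) * Complex.I_sq

theorem fderiv_eq_wirtinger (f : ℂ × K → ℂ) (q : ℂ × K) (w : ℂ) :
    fderiv ℝ f q (w, 0) = w * wirtinger f q + conj w * wirtingerBar f q :=
  apply_eq_wirtinger _ w

theorem contDiffOn_fderiv_apply {f : ℂ × K → ℂ} {s : Set (ℂ × K)} (hs : IsOpen s)
    (hf : ContDiffOn ℝ ∞ f s) (v : ℂ × K) : ContDiffOn ℝ ∞ (fun q => fderiv ℝ f q v) s :=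
  (hf.fderiv_of_isOpen hs (by simp)).clm_apply contDiffOn_const

theorem contDiffOn_wirtinger {f : ℂ × K → ℂ} {s : Set (ℂ × K)} (hs : IsOpen s)
    (hf : ContDiffOn ℝ ∞ f s) : ContDiffOn ℝ ∞ (wirtinger f) s :=
  ((contDiffOn_fderiv_apply hs hf _).sub
    (contDiffOn_const.mul (contDiffOn_fderiv_apply hs hf _))).div_const _

theorem contDiffOn_wirtingerBar {f : ℂ × K → ℂ} {s : Set (ℂ × K)} (hs : IsOpen s)
    (hf : ContDiffOn ℝ ∞ f s) : ContDiffOn ℝ ∞ (wirtingerBar f) s :=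
  ((contDiffOn_fderiv_apply hs hf _).add
    (contDiffOn_const.mul (contDiffOn_fderiv_apply hs hf _))).div_const _

variable {y₀ : K} {r : ℝ}

omit [NormedSpace ℝ K] in
theorem smul_fst_mem_ball {q : ℂ × K} (hq : q ∈ ball ((0 : ℂ), y₀) r) {t : ℝ}
    (ht : t ∈ Icc (0 : ℝ) 1) : ((t : ℂ) * q.1, q.2) ∈ ball ((0 : ℂ), y₀) r := by
  rw [mem_ball, Prod.dist_eq, max_lt_iff, dist_zero_right] at hq ⊢
  refine ⟨lt_of_le_of_lt ?_ hq.1, hq.2⟩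
  rw [norm_mul, Complex.norm_real, Real.norm_eq_abs, abs_of_nonneg ht.1]
  exact mul_le_of_le_one_left (norm_nonneg _) ht.2

theorem contDiffOn_radial_integral {φ : ℂ × K → ℂ} (a : ℝ → ℂ) (ha : ContDiff ℝ ∞ a)
    (hφ : ContDiffOn ℝ ∞ φ (ball ((0 : ℂ), y₀) r)) :
    ContDiffOn ℝ ∞ (fun q => ∫ t in (0 : ℝ)..1, a t * φ ((t : ℂ) * q.1, q.2))
      (ball ((0 : ℂ), y₀) r) := by
  intro q hq
  refine (contDiffAt_intervalIntegral (g := fun z : (ℂ × K) × ℝ =>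
    a z.2 * φ ((z.2 : ℂ) * z.1.1, z.1.2)) fun t ht => ?_).contDiffWithinAt
  have h1 : ContDiffAt ℝ ∞ φ ((t : ℂ) * q.1, q.2) :=
    hφ.contDiffAt (isOpen_ball.mem_nhds (smul_fst_mem_ball hq ht))
  refine ContDiffAt.mul (ha.contDiffAt.comp _ contDiffAt_snd) ?_
  refine ContDiffAt.comp (q, t) (f := fun z : (ℂ × K) × ℝ => ((z.2 : ℂ) * z.1.1, z.1.2)) h1
    (ContDiff.contDiffAt ?_)
  exact ((Complex.ofRealCLM.contDiff.comp contDiff_snd).mul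
    (contDiff_fst.comp contDiff_fst)).prodMk (contDiff_snd.comp contDiff_fst)

theorem hasDerivAt_radial {f : ℂ × K → ℂ} (hf : ContDiffOn ℝ ∞ f (ball ((0 : ℂ), y₀) r))
    {q : ℂ × K} (hq : q ∈ ball ((0 : ℂ), y₀) r) {t : ℝ} (ht : t ∈ Icc (0 : ℝ) 1) :
    HasDerivAt (fun s : ℝ => f ((s : ℂ) * q.1, q.2))
      (q.1 * wirtinger f ((t : ℂ) * q.1, q.2)
        + conj q.1 * wirtingerBar f ((t : ℂ) * q.1, q.2)) t := by
  rw [← fderiv_eq_wirtinger]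
  have h1 : HasFDerivAt f (fderiv ℝ f ((t : ℂ) * q.1, q.2)) ((t : ℂ) * q.1, q.2) :=
    ((hf.contDiffAt (isOpen_ball.mem_nhds (smul_fst_mem_ball hq ht))).differentiableAt
      (by simp)).hasFDerivAt
  have h2 : HasDerivAt (fun s : ℝ => ((s : ℂ) * q.1, q.2)) (q.1, 0) t := by
    have := (Complex.ofRealCLM.hasDerivAt (x := t)).mul_const q.1
    simpa using this.prodMk (hasDerivAt_const t q.2)
  exact h1.comp_hasDerivAt t h2

theorem continuousOn_radial {φ : ℂ × K → ℂ} (hφ : ContDiffOn ℝ ∞ φ (ball ((0 : ℂ), y₀) r))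
    {q : ℂ × K} (hq : q ∈ ball ((0 : ℂ), y₀) r) :
    ContinuousOn (fun t : ℝ => φ ((t : ℂ) * q.1, q.2)) (Icc 0 1) :=
  hφ.continuousOn.comp (by fun_prop) fun _ ht => smul_fst_mem_ball hq ht

theorem intervalIntegrable_radial {φ : ℂ × K → ℂ} (a : ℝ → ℂ) (ha : Continuous a)
    (hφ : ContDiffOn ℝ ∞ φ (ball ((0 : ℂ), y₀) r))
    {q : ℂ × K} (hq : q ∈ ball ((0 : ℂ), y₀) r) :
    IntervalIntegrable (fun t : ℝ => a t * φ ((t : ℂ) * q.1, q.2)) volume 0 1 := by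
  refine ContinuousOn.intervalIntegrable ?_
  rw [uIcc_of_le zero_le_one]
  exact ha.continuousOn.mul (continuousOn_radial hφ hq)

/-- Hadamard's lemma in the first variable. -/
theorem eq_radial_integral {f : ℂ × K → ℂ} (hf : ContDiffOn ℝ ∞ f (ball ((0 : ℂ), y₀) r))
    (h0 : ∀ y, ((0 : ℂ), y) ∈ ball ((0 : ℂ), y₀) r → f (0, y) = 0)
    {q : ℂ × K} (hq : q ∈ ball ((0 : ℂ), y₀) r) :
    f q = q.1 * (∫ t in (0 : ℝ)..1, 1 * wirtinger f ((t : ℂ) * q.1, q.2))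
      + conj q.1 * (∫ t in (0 : ℝ)..1, 1 * wirtingerBar f ((t : ℂ) * q.1, q.2)) := by
  have i1 := intervalIntegrable_radial (fun _ => 1) continuous_const
    (contDiffOn_wirtinger isOpen_ball hf) hq
  have i2 := intervalIntegrable_radial (fun _ => 1) continuous_const
    (contDiffOn_wirtingerBar isOpen_ball hf) hq
  rw [← intervalIntegral.integral_const_mul, ← intervalIntegral.integral_const_mul,
    ← intervalIntegral.integral_add (i1.const_mul _) (i2.const_mul _)]
  simp only [one_mul] at i1 i2 ⊢
  rw [intervalIntegral.integral_eq_sub_of_hasDerivAt (f := fun s : ℝ => f ((s : ℂ) * q.1, q.2))]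
  · have := smul_fst_mem_ball hq (t := 0) (by simp)
    simp only [Complex.ofReal_zero, zero_mul] at this
    simp [h0 _ this]
  · intro t ht
    rw [uIcc_of_le zero_le_one] at ht
    exact hasDerivAt_radial hf hq ht
  · exact (i1.const_mul _).add (i2.const_mul _)

/-- If `z` divides `f * conj z` in the smooth functions, it divides `f`. -/
theorem exists_eq_fst_mul_of_mul_conj {f G : ℂ × K → ℂ}
    (hf : ContDiffOn ℝ ∞ f (ball ((0 : ℂ), y₀) r))
    (hG : ContDiffOn ℝ ∞ G (ball ((0 : ℂ), y₀) r))
    (h : ∀ q ∈ ball ((0 : ℂ), y₀) r, f q * conj q.1 = q.1 * G q) :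
    ∃ W : ℂ × K → ℂ, ContDiffOn ℝ ∞ W (ball ((0 : ℂ), y₀) r) ∧
      ∀ q ∈ ball ((0 : ℂ), y₀) r, f q = q.1 * W q := by
  have hR : ContDiffOn ℝ ∞ (fun q => wirtinger f q + wirtingerBar G q) (ball ((0 : ℂ), y₀) r) :=
    (contDiffOn_wirtinger isOpen_ball hf).add (contDiffOn_wirtingerBar isOpen_ball hG)
  -- The integrand is chosen so that z times it is the derivative of t f(tz, y) in t.
  refine ⟨fun q => ∫ t in (0 : ℝ)..1, (t : ℂ) * (wirtinger f ((t : ℂ) * q.1, q.2)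
    + wirtingerBar G ((t : ℂ) * q.1, q.2)),
    contDiffOn_radial_integral (fun t => (t : ℂ)) Complex.ofRealCLM.contDiff hR, fun q hq => ?_⟩
  -- Apply ∂/∂z̄ to f z̄ = zG; this operator treats the factor z as a constant.
  have euler : ∀ q ∈ ball ((0 : ℂ), y₀) r,
      f q + conj q.1 * wirtingerBar f q = q.1 * wirtingerBar G q := by
    intro q hq
    have hmem := isOpen_ball.mem_nhds hq
    have df : HasFDerivAt f (fderiv ℝ f q) q :=
      ((hf.contDiffAt hmem).differentiableAt (by simp)).hasFDerivAt
    have dG : HasFDerivAt G (fderiv ℝ G q) q :=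
      ((hG.contDiffAt hmem).differentiableAt (by simp)).hasFDerivAt
    have dz : HasFDerivAt (fun q : ℂ × K => q.1) (ContinuousLinearMap.fst ℝ ℂ K) q :=
      hasFDerivAt_fst
    have dzb : HasFDerivAt (fun q : ℂ × K => conj q.1)
        ((Complex.conjCLE : ℂ →L[ℝ] ℂ).comp (ContinuousLinearMap.fst ℝ ℂ K)) q :=
      (Complex.conjCLE : ℂ →L[ℝ] ℂ).hasFDerivAt.comp q dz
    have e : (fun q : ℂ × K => f q * conj q.1) =ᶠ[𝓝 q] fun q => q.1 * G q := by
      filter_upwards [hmem] with x hx using h x hx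
    have key := ((df.mul dzb).congr_of_eventuallyEq e.symm).unique (dz.mul dG)
    have k1 := congrArg (fun A : ℂ × K →L[ℝ] ℂ => A (1, 0)) key
    have k2 := congrArg (fun A : ℂ × K →L[ℝ] ℂ => A (Complex.I, 0)) key
    simp only [add_apply, smul_apply, ContinuousLinearMap.comp_apply, smul_eq_mul,
      ContinuousLinearMap.coe_fst', ContinuousLinearEquiv.coe_coe, Complex.conjCLE_apply,
      map_one, Complex.conj_I] at k1 k2
    simp only [wirtingerBar]
    linear_combination (1 / 2) * k1 + (Complex.I / 2) * k2 + (f q / 2 + G q / 2) * Complex.I_sq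
  -- The weight t produces the undifferentiated f that `euler` needs: at (tz, y) it replaces f + t
  -- z̄ ∂f/∂z̄ by t z ∂G/∂z̄, and every remaining term contains z.
  have hd : ∀ t ∈ Icc (0 : ℝ) 1, HasDerivAt (fun s : ℝ => (s : ℂ) * f ((s : ℂ) * q.1, q.2))
      (q.1 * ((t : ℂ) * (wirtinger f ((t : ℂ) * q.1, q.2)
        + wirtingerBar G ((t : ℂ) * q.1, q.2)))) t := by
    intro t ht
    have h1 := (Complex.ofRealCLM.hasDerivAt (x := t)).mul (hasDerivAt_radial hf hq ht)
    have h2 := euler _ (smul_fst_mem_ball hq ht)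
    simp only [map_mul, Complex.conj_ofReal] at h2
    convert! h1 using 1
    simp only [Complex.ofRealCLM_apply, Complex.ofReal_one]
    linear_combination -h2
  have i := intervalIntegrable_radial (fun t => (t : ℂ)) Complex.continuous_ofReal hR hq
  rw [← intervalIntegral.integral_const_mul,
    intervalIntegral.integral_eq_sub_of_hasDerivAt
      (f := fun s : ℝ => (s : ℂ) * f ((s : ℂ) * q.1, q.2))]
  · simp
  · intro t ht
    rw [uIcc_of_le zero_le_one] at ht
    exact hd t ht
  · exact i.const_mul _

/-- A smooth function with the modulus of a multiple of `z`, whose derivative along the axis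
preserves the orientation, is divisible by `z`. -/
theorem exists_eq_fst_mul_of_mul_conj_self {f : ℂ × K → ℂ} {c : ℂ} (hr : 0 < r)
    (hf : ContDiffOn ℝ ∞ f (ball ((0 : ℂ), y₀) r))
    (h : ∀ q ∈ ball ((0 : ℂ), y₀) r, f q * conj (f q) = c * (q.1 * conj q.1))
    (hw : wirtinger f (0, y₀) ≠ 0) :
    ∃ ρ > 0, ρ ≤ r ∧ ∃ W : ℂ × K → ℂ, ContDiffOn ℝ ∞ W (ball ((0 : ℂ), y₀) ρ) ∧
      ∀ q ∈ ball ((0 : ℂ), y₀) ρ, f q = q.1 * W q := by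
  have h0 : ∀ y, ((0 : ℂ), y) ∈ ball ((0 : ℂ), y₀) r → f (0, y) = 0 := by
    intro y hy
    have := h _ hy
    simpa using this
  -- Hadamard coefficients: f = zH + z̄k, where H at the center is ∂f/∂z, nonzero by `hw`.
  set H : ℂ × K → ℂ := fun q => ∫ t in (0 : ℝ)..1, 1 * wirtinger f ((t : ℂ) * q.1, q.2) with hH
  set k : ℂ × K → ℂ := fun q => ∫ t in (0 : ℝ)..1, 1 * wirtingerBar f ((t : ℂ) * q.1, q.2) with hk
  have sH : ContDiffOn ℝ ∞ H (ball ((0 : ℂ), y₀) r) :=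
    contDiffOn_radial_integral (fun _ => 1) contDiff_const (contDiffOn_wirtinger isOpen_ball hf)
  have sk : ContDiffOn ℝ ∞ k (ball ((0 : ℂ), y₀) r) :=
    contDiffOn_radial_integral (fun _ => 1) contDiff_const (contDiffOn_wirtingerBar isOpen_ball hf)
  have hfk : ∀ q ∈ ball ((0 : ℂ), y₀) r, f q = q.1 * H q + conj q.1 * k q :=
    fun q hq => eq_radial_integral hf h0 hq
  have hH0 : H (0, y₀) ≠ 0 := by simpa [hH] using hw
  have hcenter : ((0 : ℂ), y₀) ∈ ball ((0 : ℂ), y₀) r := mem_ball_self hr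
  have hev : ∀ᶠ q in 𝓝 ((0 : ℂ), y₀), H q ≠ 0 :=
    (sH.continuousOn.continuousAt (isOpen_ball.mem_nhds hcenter)).eventually_ne hH0
  obtain ⟨ε, hε, hball⟩ := Metric.eventually_nhds_iff_ball.1 hev
  have hsub : ball ((0 : ℂ), y₀) (min ε r) ⊆ ball ((0 : ℂ), y₀) r :=
    ball_subset_ball (min_le_right _ _)
  have cconj : ContDiff ℝ ∞ (fun z : ℂ => conj z) := Complex.conjCLE.contDiff
  -- Insert conj f = z̄ conj H + z conj k into f conj f = c z z̄ and solve for f z̄; on the smaller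
  -- ball conj H can be inverted.
  refine ⟨min ε r, lt_min hε hr, min_le_right _ _, exists_eq_fst_mul_of_mul_conj
    (G := fun q => (c * conj q.1 - conj (k q) * f q) / conj (H q)) (hf.mono hsub) ?_ ?_⟩
  · simp only [div_eq_mul_inv]
    refine ContDiffOn.mul ?_ (ContDiffOn.inv (cconj.comp_contDiffOn (sH.mono hsub)) ?_)
    · exact (contDiffOn_const.mul (cconj.comp contDiff_fst).contDiffOn).sub
        ((cconj.comp_contDiffOn (sk.mono hsub)).mul (hf.mono hsub))
    · intro q hq
      simpa using hball q (ball_subset_ball (min_le_left _ _) hq)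
  · intro q hq
    have hHq : conj (H q) ≠ 0 := by simpa using hball q (ball_subset_ball (min_le_left _ _) hq)
    have e1 := h q (hsub hq)
    have e2 := congrArg conj (hfk q (hsub hq))
    simp only [map_add, map_mul, Complex.conj_conj] at e2
    rw [e2] at e1
    field_simp
    linear_combination e1

end Division

/-! ### Straightening a regular zero. -/

section Straightening

open Set Metric ComplexConjugate

theorem IsPreconnected.eq_of_eventually_eq {X Y : Type*} [TopologicalSpace X] {s : Set X}
    (hs : IsPreconnected s) {m : X → Y} (hm : ∀ x ∈ s, ∀ᶠ y in 𝓝 x, m y = m x) {x y : X}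
    (hx : x ∈ s) (hy : y ∈ s) : m x = m y := by
  have := isPreconnected_iff_preconnectedSpace.1 hs
  have h : IsLocallyConstant fun z : s => m z := by
    rw [IsLocallyConstant.iff_eventually_eq]
    exact fun z => continuous_subtype_val.continuousAt.eventually (hm z z.2)
  exact h.apply_eq_of_preconnectedSpace ⟨x, hx⟩ ⟨y, hy⟩

/-- Polar coordinates make the punctured disc a continuous image of an interval times a line. -/
theorem isPreconnected_ball_diff_zero (r : ℝ) : IsPreconnected (ball (0 : ℂ) r \ {0}) := by
  have h : ball (0 : ℂ) r \ {0} =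
      (fun p : ℝ × ℝ => (p.1 : ℂ) * Complex.exp (p.2 * Complex.I)) '' (Ioo 0 r ×ˢ univ) := by
    ext z
    constructor
    · rintro ⟨hz, h0⟩
      refine ⟨(‖z‖, z.arg), ⟨⟨norm_pos_iff.2 h0, by simpa using hz⟩, trivial⟩, ?_⟩
      exact Complex.norm_mul_exp_arg_mul_I z
    · rintro ⟨⟨t, θ⟩, ⟨⟨h0, hr⟩, -⟩, rfl⟩
      refine ⟨?_, ?_⟩
      · simpa [Complex.norm_exp_ofReal_mul_I, abs_of_pos h0] using hr
      · simp [h0.ne', Complex.exp_ne_zero]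
  rw [h]
  exact (isPreconnected_Ioo.prod isPreconnected_univ).image _ (by fun_prop)

theorem LinearMap.det_complex (T : ℂ →ₗ[ℝ] ℂ) :
    LinearMap.det T = (T 1).re * (T Complex.I).im - (T Complex.I).re * (T 1).im := by
  rw [← LinearMap.det_toMatrix Complex.basisOneI, Matrix.det_fin_two]
  simp [LinearMap.toMatrix_apply]

/-- In the form T w = a w + b w̄ the determinant is |a|² - |b|², so a cannot vanish. -/
theorem wirtinger_ne_zero_of_det_pos {T : ℂ →ₗ[ℝ] ℂ} (hT : 0 < LinearMap.det T) :
    (T 1 - Complex.I * T Complex.I) / 2 ≠ 0 := by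
  intro h
  have h1 : T 1 = Complex.I * T Complex.I := by linear_combination 2 * h
  rw [LinearMap.det_complex, h1] at hT
  simp at hT
  nlinarith [sq_nonneg (T Complex.I).re, sq_nonneg (T Complex.I).im]

variable {E : Type*} [NormedAddCommGroup E] [NormedSpace ℝ E] [CompleteSpace E]
  {F : Type*} [NormedAddCommGroup F] [NormedSpace ℝ F]

/-- The inverse of the local homeomorphism is smooth wherever the derivative of Φ is invertible, an
open condition; the source is shrunk to such points to get smoothness on the whole target. -/
theorem exists_openPartialHomeomorph_contDiffOn_symm {Φ : E → F} {U : Set E} (hU : IsOpen U)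
    {x₀ : E} (hx₀ : x₀ ∈ U) (hΦ : ContDiffOn ℝ ∞ Φ U) {e : E ≃L[ℝ] F}
    (he : HasFDerivAt Φ (e : E →L[ℝ] F) x₀) :
    ∃ h : OpenPartialHomeomorph E F, ⇑h = Φ ∧ x₀ ∈ h.source ∧ h.source ⊆ U ∧
      ContDiffOn ℝ ∞ h.symm h.target := by
  have hΦ₀ : ContDiffAt ℝ ∞ Φ x₀ := hΦ.contDiffAt (hU.mem_nhds hx₀)
  set h₀ := hΦ₀.toOpenPartialHomeomorph Φ he (by simp)
  set U' : Set E := U ∩ fderiv ℝ Φ ⁻¹' range ((↑) : (E ≃L[ℝ] F) → E →L[ℝ] F)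
  have hU' : IsOpen U' :=
    (hΦ.continuousOn_fderiv_of_isOpen hU (by simp)).isOpen_inter_preimage hU
      ContinuousLinearEquiv.isOpen
  refine ⟨h₀.restrOpen U' hU', rfl, ?_, ?_, ?_⟩
  · exact ⟨hΦ₀.mem_toOpenPartialHomeomorph_source he (by simp), hx₀, e, he.fderiv.symm⟩
  · exact fun x hx => hx.2.1
  · intro y hy
    have hx := (h₀.restrOpen U' hU').map_target hy
    obtain ⟨e', he'⟩ := hx.2.2
    have hxU := hΦ.contDiffAt (hU.mem_nhds hx.2.1)
    have hd := (hxU.differentiableAt (by simp)).hasFDerivAt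
    rw [← he'] at hd
    exact ((h₀.restrOpen U' hU').contDiffAt_symm hy hd hxU).contDiffWithinAt

/-- Let `g` have a regular zero at `x₀`. A function `f` with the same zeros and the same
orientation at `x₀`, whose modulus is locally a multiple of that of `g`, is the product of `g`
and a smooth function without zeros. -/
theorem exists_eq_mul_of_regular_zero {f g : E → ℂ} {U : Set E} (hU : IsOpen U) {x₀ : E}
    (hx₀ : x₀ ∈ U) (hf : ContDiffOn ℝ ∞ f U) (hg : ContDiffOn ℝ ∞ g U) (hg₀ : g x₀ = 0)
    (hz : ∀ x ∈ U, f x = 0 ↔ g x = 0) (hsurj : Function.Surjective (fderiv ℝ g x₀))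
    {T : ℂ →ₗ[ℝ] ℂ} (hT : 0 < LinearMap.det T)
    (hfg : ∀ v, fderiv ℝ f x₀ v = T (fderiv ℝ g x₀ v))
    (hc : ∀ x ∈ U, g x ≠ 0 → ∀ᶠ y in 𝓝 x, ‖f y‖ / ‖g y‖ = ‖f x‖ / ‖g x‖) :
    ∃ V : Set E, IsOpen V ∧ x₀ ∈ V ∧ V ⊆ U ∧ ∃ W : E → ℂ, ContDiffOn ℝ ∞ W V ∧
      ∀ x ∈ V, W x ≠ 0 ∧ f x = W x * g x := by
  set A := fderiv ℝ g x₀ with hA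
  obtain ⟨pr, hpr⟩ := A.ker_closedComplemented_of_finiteDimensional_range
  have gd : HasFDerivAt g A x₀ :=
    ((hg.contDiffAt (hU.mem_nhds hx₀)).differentiableAt (by simp)).hasFDerivAt
  have fd : HasFDerivAt f (fderiv ℝ f x₀) x₀ :=
    ((hf.contDiffAt (hU.mem_nhds hx₀)).differentiableAt (by simp)).hasFDerivAt
  set e : E ≃L[ℝ] ℂ × A.ker := A.equivProdOfSurjectiveOfIsCompl pr
    (LinearMap.range_eq_top.2 hsurj) (LinearMap.range_eq_of_proj hpr) (LinearMap.isCompl_of_proj hpr)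
  -- `Φ` completes g to a chart with g as first coordinate z. The projection `pr` onto the kernel of
  -- dg exists because dg has finite-dimensional range.
  set Φ : E → ℂ × A.ker := fun x => (g x, pr (x - x₀)) with hΦdef
  have hΦ : ContDiffOn ℝ ∞ Φ U :=
    hg.prodMk (pr.contDiff.comp (contDiff_id.sub contDiff_const)).contDiffOn
  have hΦ' : HasFDerivAt Φ (e : E →L[ℝ] ℂ × A.ker) x₀ :=
    gd.prodMk (pr.hasFDerivAt.comp x₀ ((hasFDerivAt_id x₀).sub_const x₀))
  obtain ⟨h, hh, hsx, hsU, hsymm⟩ := exists_openPartialHomeomorph_contDiffOn_symm hU hx₀ hΦ hΦ'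
  have hhx : ∀ x, h x = (g x, pr (x - x₀)) := fun x => by rw [hh]
  have hhx₀ : h x₀ = ((0 : ℂ), (0 : A.ker)) := by simp [hhx, hg₀]
  have hgsymm : ∀ q ∈ h.target, g (h.symm q) = q.1 := fun q hq => by
    have := h.right_inv hq
    rw [hhx] at this
    exact congrArg Prod.fst this
  have hUsymm : ∀ q ∈ h.target, h.symm q ∈ U := fun q hq => hsU (h.map_target hq)
  have htgt : ((0 : ℂ), (0 : A.ker)) ∈ h.target := hhx₀ ▸ h.map_source hsx
  obtain ⟨r, hr, hball⟩ := Metric.isOpen_iff.1 h.open_target _ htgt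
  set f' : ℂ × A.ker → ℂ := f ∘ h.symm with hf'
  have sf' : ContDiffOn ℝ ∞ f' (ball ((0 : ℂ), (0 : A.ker)) r) :=
    (hf.comp hsymm fun q hq => hUsymm q hq).mono hball
  have hz' : ∀ q ∈ ball ((0 : ℂ), (0 : A.ker)) r, f' q = 0 ↔ q.1 = 0 := fun q hq => by
    rw [hf', Function.comp_apply, hz _ (hUsymm q (hball hq)), hgsymm q (hball hq)]
  -- The set z = 0 has real codimension two, so its complement in the ball is connected and the
  -- locally constant quotient |f'|/|z| has a single value there.
  have hs : IsPreconnected ((ball (0 : ℂ) r \ {0}) ×ˢ ball (0 : A.ker) r) :=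
    (isPreconnected_ball_diff_zero r).prod isPreconnected_ball
  have hsb : ∀ q ∈ (ball (0 : ℂ) r \ {0}) ×ˢ ball (0 : A.ker) r,
      q ∈ ball ((0 : ℂ), (0 : A.ker)) r := fun q hq => by
    rw [← ball_prod_same]; exact ⟨hq.1.1, hq.2⟩
  have hloc : ∀ q ∈ (ball (0 : ℂ) r \ {0}) ×ˢ ball (0 : A.ker) r,
      ∀ᶠ q' in 𝓝 q, ‖f' q'‖ / ‖q'.1‖ = ‖f' q‖ / ‖q.1‖ := by
    intro q hq
    have hqt := hball (hsb q hq)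
    have h1 := hc (h.symm q) (hUsymm q hqt) (by rw [hgsymm q hqt]; exact hq.1.2)
    filter_upwards [(h.symm.continuousAt hqt).eventually h1, h.open_target.mem_nhds hqt]
      with q' h2 hq't
    rwa [hgsymm q hqt, hgsymm q' hq't] at h2
  obtain ⟨c, hcc⟩ : ∃ c : ℝ, ∀ q ∈ ball ((0 : ℂ), (0 : A.ker)) r, ‖f' q‖ = c * ‖q.1‖ := by
    have hq₀ : (((r / 2 : ℝ) : ℂ), (0 : A.ker)) ∈ (ball (0 : ℂ) r \ {0}) ×ˢ ball (0 : A.ker) r := by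
      refine ⟨⟨?_, ?_⟩, mem_ball_self hr⟩
      · rw [mem_ball_zero_iff, Complex.norm_real, Real.norm_eq_abs, abs_of_pos (by linarith)]
        linarith
      · simpa using hr.ne'
    refine ⟨‖f' (((r / 2 : ℝ) : ℂ), (0 : A.ker))‖ / ‖((r / 2 : ℝ) : ℂ)‖, fun q hq => ?_⟩
    by_cases hq0 : q.1 = 0
    · rw [hq0, (hz' q hq).2 hq0]; simp
    · have hq' : q ∈ (ball (0 : ℂ) r \ {0}) ×ˢ ball (0 : A.ker) r := by
        rw [← ball_prod_same] at hq; exact ⟨⟨hq.1, hq0⟩, hq.2⟩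
      rw [← hs.eq_of_eventually_eq hloc hq' hq₀, div_mul_cancel₀ _ (norm_ne_zero_iff.2 hq0)]
  have hmod : ∀ q ∈ ball ((0 : ℂ), (0 : A.ker)) r,
      f' q * conj (f' q) = ((c ^ 2 : ℝ) : ℂ) * (q.1 * conj q.1) := by
    intro q hq
    rw [Complex.mul_conj, Complex.mul_conj, Complex.normSq_eq_norm_sq, Complex.normSq_eq_norm_sq,
      hcc q hq]
    push_cast; ring
  -- In the new coordinates dg is the first projection, so df = T ∘ dg says that f' has derivative T
  -- in the direction of z.
  have hd : ∀ w : ℂ, fderiv ℝ f' (0, 0) (w, 0) = T w := by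
    intro w
    have d1 : HasFDerivAt f' (fderiv ℝ f' (0, 0)) (h x₀) := by
      rw [hhx₀]
      exact ((sf'.contDiffAt (isOpen_ball.mem_nhds (mem_ball_self hr))).differentiableAt
        (by simp)).hasFDerivAt
    have d2 := d1.comp x₀ (hh ▸ hΦ')
    have d3 : f' ∘ h =ᶠ[𝓝 x₀] f := by
      filter_upwards [h.open_source.mem_nhds hsx] with x hx
      simp [hf', h.left_inv hx]
    have d4 := (d2.congr_of_eventuallyEq d3.symm).unique fd
    have d5 := congrArg (fun B : E →L[ℝ] ℂ => B (e.symm (w, 0))) d4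
    have d6 : A (e.symm (w, 0)) = w := congrArg Prod.fst (e.apply_symm_apply (w, 0))
    simp only [ContinuousLinearMap.comp_apply, ContinuousLinearEquiv.coe_coe,
      ContinuousLinearEquiv.apply_symm_apply] at d5
    rw [d5, hfg, d6]
  obtain ⟨ρ, hρ, hρr, W, sW, hW⟩ := exists_eq_fst_mul_of_mul_conj_self hr sf' hmod (by
    rw [wirtinger, hd, hd]; exact wirtinger_ne_zero_of_det_pos hT)
  -- If W vanished at the center, zW would have zero derivative there, which contradicts det T > 0.
  have hW0 : W (0, 0) ≠ 0 := by
    intro h0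
    have hb := isOpen_ball.mem_nhds (mem_ball_self (x := ((0 : ℂ), (0 : A.ker))) hρ)
    have d1 : HasFDerivAt W (fderiv ℝ W (0, 0)) ((0 : ℂ), (0 : A.ker)) :=
      ((sW.contDiffAt hb).differentiableAt (by simp)).hasFDerivAt
    have d2 := (hasFDerivAt_fst (𝕜 := ℝ) (p := ((0 : ℂ), (0 : A.ker)))).mul d1
    have d3 : f' =ᶠ[𝓝 ((0 : ℂ), (0 : A.ker))] fun q => q.1 * W q := by
      filter_upwards [hb] with q hq using hW q hq
    have d4 : fderiv ℝ f' (0, 0) = 0 := by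
      rw [(d2.congr_of_eventuallyEq d3).fderiv, h0]
      ext v <;> simp
    have d5 : ∀ w, T w = 0 := fun w => by rw [← hd, d4]; rfl
    rw [LinearMap.det_complex, d5, d5] at hT
    simp at hT
  have hρt : ball ((0 : ℂ), (0 : A.ker)) ρ ⊆ h.target := (ball_subset_ball hρr).trans hball
  have hev : ∀ᶠ q in 𝓝 ((0 : ℂ), (0 : A.ker)), W q ≠ 0 :=
    (sW.continuousOn.continuousAt
      (isOpen_ball.mem_nhds (mem_ball_self hρ))).eventually_ne hW0
  obtain ⟨ε, hε, hball'⟩ := Metric.eventually_nhds_iff_ball.1 hev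
  refine ⟨h.source ∩ h ⁻¹' ball (0, 0) (min ρ ε), h.isOpen_inter_preimage isOpen_ball, ⟨hsx, ?_⟩,
    fun x hx => hsU hx.1, W ∘ h, ?_, ?_⟩
  · rw [mem_preimage, hhx₀]; exact mem_ball_self (lt_min hρ hε)
  · refine sW.comp ((hh ▸ hΦ).mono fun x hx => hsU hx.1) fun x hx =>
      ball_subset_ball (min_le_left _ _) hx.2
  · rintro x ⟨hx, hxb⟩
    refine ⟨hball' _ (ball_subset_ball (min_le_right _ _) hxb), ?_⟩
    have h1 := hW _ (ball_subset_ball (min_le_left _ _) hxb)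
    rw [hf', Function.comp_apply, h.left_inv hx] at h1
    rw [h1, hhx, Function.comp_apply, hhx, mul_comm]

end Straightening

/-! ### Calculus on manifolds and the existence of phases. -/

section Manifold

open Set

variable {E : Type*} [NormedAddCommGroup E] [NormedSpace ℝ E]
  {H : Type*} [TopologicalSpace H] {I : ModelWithCorners ℝ E H} [I.Boundaryless]
  {M : Type*} [TopologicalSpace M] [ChartedSpace H M] [IsManifold I ∞ M]
  {V : Type*} [NormedAddCommGroup V] [NormedSpace ℝ V]

theorem contMDiffAt_extChartAt_symm {p : M} {e : E} (he : e ∈ (extChartAt I p).target) :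
    ContMDiffAt 𝓘(ℝ, E) I ∞ (extChartAt I p).symm e :=
  (contMDiffOn_extChartAt_symm p).contMDiffAt ((isOpen_extChartAt_target p).mem_nhds he)

theorem ContMDiffAt.contDiffAt_comp_extChartAt_symm {f : M → V} {p : M} {e : E}
    (he : e ∈ (extChartAt I p).target) (hf : ContMDiffAt I 𝓘(ℝ, V) ∞ f ((extChartAt I p).symm e)) :
    ContDiffAt ℝ ∞ (f ∘ (extChartAt I p).symm) e :=
  (hf.comp e (contMDiffAt_extChartAt_symm he)).contDiffAt

theorem fderiv_comp_extChartAt_symm {f : M → V} {p : M} {e : E}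
    (he : e ∈ (extChartAt I p).target)
    (hf : MDifferentiableAt I 𝓘(ℝ, V) f ((extChartAt I p).symm e)) (v : E) :
    fderiv ℝ (f ∘ (extChartAt I p).symm) e v =
      mvfderiv I f ((extChartAt I p).symm e)
        (mfderiv 𝓘(ℝ, E) I (extChartAt I p).symm e v) := by
  have h := (contMDiffAt_extChartAt_symm (I := I) he).mdifferentiableAt (by simp)
  rw [← mfderiv_eq_fderiv, mfderiv_comp e hf h]
  rfl

omit [IsManifold I ∞ M] in
theorem fderiv_comp_extChartAt_symm_self {f : M → V} {p : M}
    (hf : MDifferentiableAt I 𝓘(ℝ, V) f p) (v : E) :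
    fderiv ℝ (f ∘ (extChartAt I p).symm) (extChartAt I p p) v = mvfderiv I f p v := by
  have h : mfderiv I 𝓘(ℝ, V) f p = fderivWithin ℝ (f ∘ (extChartAt I p).symm) (range I)
    (extChartAt I p p) := by
    rw [hf.mfderiv]; rfl
  rw [I.range_eq_univ, fderivWithin_univ] at h
  rw [← h]; rfl

theorem eventually_eq_of_mvfderiv_eq_zero {f : M → V} {U : Set M} (hU : IsOpen U)
    (hf : ∀ x ∈ U, MDifferentiableAt I 𝓘(ℝ, V) f x) (hd : ∀ x ∈ U, mvfderiv I f x = 0)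
    {p : M} (hp : p ∈ U) : ∀ᶠ x in 𝓝 p, f x = f p := by
  set φ := extChartAt I p
  have hO : IsOpen (φ.target ∩ φ.symm ⁻¹' U) :=
    (continuousOn_extChartAt_symm p).isOpen_inter_preimage (isOpen_extChartAt_target p) hU
  have hpO : φ p ∈ φ.target ∩ φ.symm ⁻¹' U :=
    ⟨mem_extChartAt_target p, by rw [mem_preimage, extChartAt_to_inv]; exact hp⟩
  obtain ⟨r, hr, hball⟩ := Metric.isOpen_iff.1 hO _ hpO
  have hdiff : DifferentiableOn ℝ (f ∘ φ.symm) (Metric.ball (φ p) r) := fun e he =>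
    ((hf _ (hball he).2).comp e ((contMDiffAt_extChartAt_symm (hball he).1).mdifferentiableAt
      (by simp))).differentiableAt.differentiableWithinAt
  have hzero : EqOn (fderiv ℝ (f ∘ φ.symm)) 0 (Metric.ball (φ p) r) := fun e he => by
    ext v
    rw [fderiv_comp_extChartAt_symm (hball he).1 (hf _ (hball he).2), hd _ (hball he).2]
    rfl
  filter_upwards [(continuousAt_extChartAt (I := I) p).preimage_mem_nhds (Metric.ball_mem_nhds _ hr),
    extChartAt_source_mem_nhds (I := I) p] with x hx hxs
  have := Metric.isOpen_ball.is_const_of_fderiv_eq_zero Metric.isPreconnected_ball hdiff hzero hx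
    (Metric.mem_ball_self hr)
  rwa [Function.comp_apply, Function.comp_apply, φ.left_inv hxs, extChartAt_to_inv] at this

theorem eq_of_mvfderiv_eq_zero [PreconnectedSpace M] {f : M → V}
    (hf : MDifferentiable I 𝓘(ℝ, V) f) (hd : ∀ x, mvfderiv I f x = 0) (x y : M) : f x = f y :=
  isPreconnected_univ.eq_of_eventually_eq (fun x _ => eventually_eq_of_mvfderiv_eq_zero isOpen_univ
    (fun x _ => hf x) (fun x _ => hd x) (mem_univ x)) (mem_univ x) (mem_univ y)

omit [I.Boundaryless] [IsManifold I ∞ M] in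
theorem contMDiffAt_of_comp_extChartAt_symm {f : M → V} {p : M}
    (hf : ContDiffAt ℝ ∞ (f ∘ (extChartAt I p).symm) (extChartAt I p p)) :
    ContMDiffAt I 𝓘(ℝ, V) ∞ f p := by
  refine (hf.contMDiffAt.comp p (contMDiffAt_extChartAt (I := I))).congr_of_eventuallyEq ?_
  filter_upwards [extChartAt_source_mem_nhds (I := I) p] with x hx
  exact congrArg f ((extChartAt I p).left_inv hx).symm

theorem contDiffAt_uncurry_comp_extChartAt_symm {F : ℝ × M → V}
    (hF : ContMDiff (𝓘(ℝ, ℝ).prod I) 𝓘(ℝ, V) ∞ F) {p : M} {e : E}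
    (he : e ∈ (extChartAt I p).target) (t : ℝ) :
    ContDiffAt ℝ ∞ (fun z : E × ℝ => F (z.2, (extChartAt I p).symm z.1)) (e, t) := by
  refine ContMDiffAt.contDiffAt ?_
  refine (hF _).comp (e, t) (f := fun z : E × ℝ => (z.2, (extChartAt I p).symm z.1)) ?_
  exact contDiffAt_snd.contMDiffAt.prodMk
    (ContMDiffAt.comp (e, t) (contMDiffAt_extChartAt_symm he) contDiffAt_fst.contMDiffAt)

/-- Used to integrate a smooth curve of functions F_t over time into a single element of C^∞(M, ℝ).
-/
theorem contMDiff_intervalIntegral {F : ℝ × M → V}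
    (hF : ContMDiff (𝓘(ℝ, ℝ).prod I) 𝓘(ℝ, V) ∞ F) :
    ContMDiff I 𝓘(ℝ, V) ∞ (fun x => ∫ t in (0 : ℝ)..1, F (t, x)) := fun p =>
  contMDiffAt_of_comp_extChartAt_symm (contDiffAt_intervalIntegral
    (g := fun z : E × ℝ => F (z.2, (extChartAt I p).symm z.1)) fun t _ =>
      contDiffAt_uncurry_comp_extChartAt_symm hF (mem_extChartAt_target p) t)

omit [I.Boundaryless] [IsManifold I ∞ M] in
theorem contDiff_curry_left {F : ℝ × M → V}
    (hF : ContMDiff (𝓘(ℝ, ℝ).prod I) 𝓘(ℝ, V) ∞ F) (x : M) :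
    ContDiff ℝ ∞ (fun t => F (t, x)) :=
  (hF.comp (contMDiff_id.prodMk contMDiff_const)).contDiff

/-- In a chart the time derivative is the joint derivative applied to the fixed vector (0, 1). It
makes the velocity of a smooth curve in C^∞(M, ℝ) an element of that space. -/
theorem contMDiff_deriv_left {F : ℝ × M → V}
    (hF : ContMDiff (𝓘(ℝ, ℝ).prod I) 𝓘(ℝ, V) ∞ F) (t : ℝ) :
    ContMDiff I 𝓘(ℝ, V) ∞ (fun x => deriv (fun s => F (s, x)) t) := by
  intro p
  refine contMDiffAt_of_comp_extChartAt_symm ?_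
  set G : E × ℝ → V := fun z => F (z.2, (extChartAt I p).symm z.1) with hG
  have hGs : ∀ e ∈ (extChartAt I p).target, ContDiffAt ℝ ∞ G (e, t) := fun e he =>
    contDiffAt_uncurry_comp_extChartAt_symm hF he t
  have h1 : ContDiffAt ℝ ∞ (fun e => fderiv ℝ G (e, t) (0, 1)) (extChartAt I p p) := by
    have h2 : ContDiffAt ℝ ∞ (fderiv ℝ G) (extChartAt I p p, t) :=
      (hGs _ (mem_extChartAt_target p)).fderiv_right (by simp)
    exact (h2.comp (extChartAt I p p) (f := fun e => (e, t))
      (contDiffAt_id.prodMk contDiffAt_const)).clm_apply contDiffAt_const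
  refine h1.congr_of_eventuallyEq ?_
  filter_upwards [(isOpen_extChartAt_target (I := I) p).mem_nhds (mem_extChartAt_target p)]
    with e he
  have h2 : HasFDerivAt G (fderiv ℝ G (e, t)) (e, t) :=
    ((hGs e he).differentiableAt (by simp)).hasFDerivAt
  have h3 : HasDerivAt (fun s : ℝ => (e, s)) (0, 1) t :=
    (hasDerivAt_const t e).prodMk (hasDerivAt_id t)
  exact (h2.comp_hasDerivAt t h3).deriv

/-- The analogue of `exists_eq_mul_of_regular_zero` on a manifold. -/
theorem exists_eq_mul_of_mvfderiv_surjective [CompleteSpace E] {f g : M → ℂ} {U : Set M}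
    (hU : IsOpen U) {p : M}
    (hp : p ∈ U) (hf : ContMDiffOn I 𝓘(ℝ, ℂ) ∞ f U) (hg : ContMDiffOn I 𝓘(ℝ, ℂ) ∞ g U)
    (hg₀ : g p = 0) (hz : ∀ x ∈ U, f x = 0 ↔ g x = 0)
    (hsurj : Function.Surjective (mvfderiv I g p)) {T : ℂ →ₗ[ℝ] ℂ} (hT : 0 < LinearMap.det T)
    (hfg : ∀ v, mvfderiv I f p v = T (mvfderiv I g p v))
    (hc : ∀ x ∈ U, g x ≠ 0 → ∀ᶠ y in 𝓝 x, ‖f y‖ / ‖g y‖ = ‖f x‖ / ‖g x‖) :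
    ∃ V : Set M, IsOpen V ∧ p ∈ V ∧ V ⊆ U ∧ ∃ W : M → ℂ, ContMDiffOn I 𝓘(ℝ, ℂ) ∞ W V ∧
      ∀ x ∈ V, W x ≠ 0 ∧ f x = W x * g x := by
  set φ := extChartAt I p
  have hO : IsOpen (φ.target ∩ φ.symm ⁻¹' U) :=
    (continuousOn_extChartAt_symm p).isOpen_inter_preimage (isOpen_extChartAt_target p) hU
  have hpO : φ p ∈ φ.target ∩ φ.symm ⁻¹' U :=
    ⟨mem_extChartAt_target p, by rw [mem_preimage, extChartAt_to_inv]; exact hp⟩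
  have hsm : ∀ k : M → ℂ, ContMDiffOn I 𝓘(ℝ, ℂ) ∞ k U →
      ContDiffOn ℝ ∞ (k ∘ φ.symm) (φ.target ∩ φ.symm ⁻¹' U) := fun k hk e he =>
    ((hk.contMDiffAt (hU.mem_nhds he.2)).contDiffAt_comp_extChartAt_symm he.1).contDiffWithinAt
  have hder : ∀ k : M → ℂ, ContMDiffOn I 𝓘(ℝ, ℂ) ∞ k U → ∀ v : E,
      fderiv ℝ (k ∘ φ.symm) (φ p) v = mvfderiv I k p v := fun k hk v =>
    fderiv_comp_extChartAt_symm_self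
      ((hk.contMDiffAt (hU.mem_nhds hp)).mdifferentiableAt (by simp)) v
  obtain ⟨V, hV, hpV, hVsub, W, hW, hWe⟩ := exists_eq_mul_of_regular_zero hO hpO (hsm f hf)
    (hsm g hg) (by simpa [φ, extChartAt_to_inv] using hg₀) (fun e he => hz _ he.2)
    (fun w => by
      obtain ⟨v, hv⟩ := hsurj w
      exact ⟨v, by rw [← hv]; exact hder g hg v⟩) hT
    (fun v => by rw [hder f hf, hder g hg]; exact hfg v)
    (fun e he h0 => ((continuousOn_extChartAt_symm p).continuousAt
      ((isOpen_extChartAt_target p).mem_nhds he.1)).eventually (hc _ he.2 h0))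
  have hback : ∀ x ∈ φ.source ∩ φ ⁻¹' V, φ.symm (φ x) = x := fun x hx => φ.left_inv hx.1
  refine ⟨φ.source ∩ φ ⁻¹' V, (continuousOn_extChartAt p).isOpen_inter_preimage
    (isOpen_extChartAt_source p) hV, ⟨mem_extChartAt_source p, hpV⟩, fun x hx => ?_, W ∘ φ, ?_, ?_⟩
  · rw [← hback x hx]; exact (hVsub hx.2).2
  · exact hW.contMDiffOn.comp ((contMDiffOn_extChartAt (x := p)).mono fun x hx => by
      simpa [φ] using hx.1) fun x hx => hx.2
  · intro x hx
    have := hWe (φ x) hx.2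
    simpa [hback x hx] using this

omit [I.Boundaryless] [IsManifold I ∞ M] in
/-- A smooth function of modulus one on a simply connected manifold has a smooth phase. -/
theorem exists_phase [SimplyConnectedSpace M] [LocallyPathConnectedSpace M] {u : M → ℂ}
    (hu : ContMDiff I 𝓘(ℝ, ℂ) ∞ u) (hn : ∀ x, ‖u x‖ = 1) :
    ∃ F : C^∞⟮I, M; 𝓘(ℝ, ℝ), ℝ⟯, ∀ x, u x = Complex.exp (Complex.I * (F x : ℂ)) := by
  have hu0 : ∀ x, u x ≠ 0 := fun x h => by simpa [h] using hn x
  obtain ⟨a⟩ : Nonempty M := inferInstance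
  -- As M is simply connected, u lifts through the covering exp : ℂ → ℂ \ {0}.
  obtain ⟨G, ⟨-, hG⟩, -⟩ := Complex.isCoveringMapOn_exp.existsUnique_continuousMap_lifts
    ⟨u, hu.continuous⟩ (a₀ := a) (e₀ := Complex.log (u a)) (Complex.exp_log (hu0 a))
    (fun x => hu0 x)
  have hG' : ∀ x, Complex.exp (G x) = u x := fun x => congrFun hG x
  have hsm : ContMDiff I 𝓘(ℝ, ℂ) ∞ G := by
    intro p
    -- The continuous lift is smooth: near p it is G p plus the principal logarithm of u / u p, a
    -- function with value 1 at p.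
    have h1 : ∀ᶠ x in 𝓝 p, G x = G p + Complex.log (u x / u p) := by
      have hc : Continuous fun x => (G x - G p).im :=
        Complex.continuous_im.comp (G.continuous.sub continuous_const)
      have h2 : ∀ᶠ x in 𝓝 p, (G x - G p).im ∈ Ioo (-Real.pi) Real.pi :=
        hc.continuousAt.eventually (isOpen_Ioo.mem_nhds (by simp [Real.pi_pos]))
      filter_upwards [h2] with x hx
      rw [← hG', ← hG', ← Complex.exp_sub, Complex.log_exp hx.1 hx.2.le]
      ring
    have h3 : ContDiffAt ℝ ∞ (fun w : ℂ => G p + Complex.log (w / u p)) (u p) := by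
      refine contDiffAt_const.add ?_
      have h4 : ContDiffAt ℝ ∞ Complex.log (u p / u p) := by
        rw [div_self (hu0 p)]
        exact (Complex.contDiffAt_log (by simp)).restrict_scalars ℝ
      exact h4.comp (u p) (f := fun w => w / u p) (contDiffAt_id.div_const _)
    exact (h3.contMDiffAt.comp p (hu p)).congr_of_eventuallyEq h1
  refine ⟨⟨fun x => (G x).im, Complex.imCLM.contDiff.contMDiff.comp hsm⟩, fun x => ?_⟩
  have h1 : (G x).re = 0 := by
    have := hn x
    rw [← hG', Complex.norm_exp] at this
    exact Real.exp_eq_one_iff _ |>.1 this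
  rw [← hG']
  congr 1
  apply Complex.ext
  · simpa using h1
  · simp only [Complex.mul_im, Complex.I_re, Complex.I_im, Complex.ofReal_re, Complex.ofReal_im,
      mul_zero, one_mul, zero_add]
    rfl

end Manifold

namespace PhaseChange

open Set

/-! ### Smooth curves, velocities and orbits of the phase changes. -/

section Curves

variable {E : Type*} [NormedAddCommGroup E] [NormedSpace ℝ E]
  {H : Type*} [TopologicalSpace H] {I : ModelWithCorners ℝ E H}
  {M : Type*} [TopologicalSpace M] [ChartedSpace H M]
  {L : M → Type*} [∀ x, NormedAddCommGroup (L x)] [∀ x, InnerProductSpace ℂ (L x)]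
  [TopologicalSpace (TotalSpace ℂ L)] [FiberBundle ℂ L]
  [VectorBundle ℂ ℂ L] [VectorBundle ℝ ℂ L]

theorem IsSmoothCurveΓ.contDiff {A : ℝ → Γ I L} (hA : IsSmoothCurveΓ A) (x : M) :
    ContDiff ℝ ∞ (fun t => (A t).1 x) := by
  set e := trivializationAt ℂ L x
  have hx : x ∈ e.baseSet := mem_baseSet_trivializationAt ℂ L x
  set l : L x ≃L[ℝ] ℂ := e.continuousLinearEquivAt ℝ x hx
  have h1 : ContDiff ℝ ∞ (fun t => l ((A t).1 x)) := by
    rw [contDiff_iff_contDiffAt]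
    intro t
    have h2 := contMDiffAt_totalSpace.1 (hA (t, x))
    exact (h2.2.comp t (f := fun s : ℝ => (s, x))
      (contMDiffAt_id.prodMk contMDiffAt_const)).contDiffAt
  simpa [Function.comp_def] using (l.symm : ℂ →L[ℝ] L x).contDiff.comp h1

theorem isSmoothCurveΓ_smul {u : ℝ → C^∞⟮I, M; 𝓘(ℝ, ℂ), ℂ⟯}
    (hu : ContMDiff (𝓘(ℝ, ℝ).prod I) 𝓘(ℝ, ℂ) ∞ (fun q : ℝ × M => u q.1 q.2)) (α : Γ I L) :
    IsSmoothCurveΓ (fun t => mulFn I (u t) α) := by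
  intro q
  rw [contMDiffAt_totalSpace]
  refine ⟨contMDiffAt_snd, ?_⟩
  have h := ((contMDiffAt_section q.2).1 (α.2 q.2)).comp q
    (contMDiffAt_snd (I := 𝓘(ℝ, ℝ)) (J := I) (n := ∞))
  have hmul := (contDiff_mul (𝕜 := ℝ) (𝔸 := ℂ) (n := ∞)).contMDiff.contMDiffAt.comp q
    ((hu q).prodMk_space h)
  refine hmul.congr_of_eventuallyEq ?_
  filter_upwards [continuousAt_snd ((trivializationAt ℂ L q.2).open_baseSet.mem_nhds
    (mem_baseSet_trivializationAt ℂ L q.2))] with z hz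
  exact ((trivializationAt ℂ L q.2).linear ℂ hz).2 (u z.1 z.2) (α.1 z.2)

theorem exists_ne_zero {α : Γ I L} (hα : α ≠ 0) : ∃ x, α.1 x ≠ 0 := by
  by_contra! h
  exact hα (Subtype.ext (funext h))

theorem mk_eq_of_smul {α β : Γ I L} (hα : α ≠ 0) (hβ : β ≠ 0) {c : ℂ} (h : β = c • α) :
    Projectivization.mk ℂ β hβ = Projectivization.mk ℂ α hα :=
  (Projectivization.mk_eq_mk_iff' ℂ _ _ _ _).2 ⟨c, h.symm⟩

theorem mem_submodule_iff {α v : Γ I L} (hα : α ≠ 0) :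
    v ∈ (Projectivization.mk ℂ α hα).submodule ↔ ∃ c : ℂ, v = c • α := by
  rw [Projectivization.submodule_mk, Submodule.mem_span_singleton]
  simp only [eq_comm]

/-- Linear maps on a line agree as soon as they agree on a nonzero vector. -/
theorem tangent_ext {p : PΓ I L} {ξ ζ : TangentPΓ p} {α : Γ I L} {hα : α ≠ 0}
    (hp : p = Projectivization.mk ℂ α hα)
    (h : ∀ v : p.submodule, (v : Γ I L) = α → ξ v = ζ v) : ξ = ζ := by
  subst hp
  have hmem : α ∈ (Projectivization.mk ℂ α hα).submodule :=
    (mem_submodule_iff hα).2 ⟨1, (one_smul _ _).symm⟩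
  ext ⟨v, hv⟩
  obtain ⟨c, rfl⟩ := (mem_submodule_iff hα).1 hv
  have : (⟨c • α, hv⟩ : (Projectivization.mk ℂ α hα).submodule) = c • ⟨α, hmem⟩ := rfl
  rw [this, map_smul, map_smul, h ⟨α, hmem⟩ rfl]

/-- The velocity of a curve can be computed with any of its smooth lifts. -/
theorem HasVelocity.exists_of_lift {γ : ℝ → PΓ I L} {t : ℝ} {p : PΓ I L} {ξ : TangentPΓ p}
    (h : HasVelocity γ t p ξ) {A : ℝ → Γ I L} (hA : IsSmoothLift γ A) :
    ∃ B : Γ I L, (∀ x, HasDerivAt (fun s => (A s).1 x) (B.1 x) t) ∧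
      ∀ v : p.submodule, (v : Γ I L) = A t → ξ v = p.submodule.mkQ B := by
  obtain ⟨rfl, A', hA', B', hB', hξ⟩ := h
  have hν : ∀ s, ∃ c : ℂ, A s = c • A' s := fun s => by
    obtain ⟨h1, e1⟩ := hA.2 s
    obtain ⟨h2, e2⟩ := hA'.2 s
    obtain ⟨c, hc⟩ := (Projectivization.mk_eq_mk_iff' ℂ _ _ h1 h2).1 (e1.symm.trans e2)
    exact ⟨c, hc.symm⟩
  choose ν hν using hν
  obtain ⟨hne, hmk⟩ := hA'.2 t
  -- The factor ν between the two lifts is read off at a point where `A' t` is nonzero; near t it is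
  -- a quotient of differentiable functions.
  obtain ⟨x₀, hx₀⟩ := exists_ne_zero hne
  set l : L x₀ ≃L[ℂ] ℂ := (trivializationAt ℂ L x₀).continuousLinearEquivAt ℂ x₀
    (mem_baseSet_trivializationAt ℂ L x₀)
  have dA' : HasDerivAt (fun s => l ((A' s).1 x₀)) (l (B'.1 x₀)) t :=
    ((l : L x₀ →L[ℂ] ℂ).restrictScalars ℝ).hasFDerivAt.comp_hasDerivAt t (hB' x₀)
  have dA : HasDerivAt (fun s => l ((A s).1 x₀)) (deriv (fun s => l ((A s).1 x₀)) t) t :=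
    ((((l : L x₀ →L[ℂ] ℂ).restrictScalars ℝ).contDiff.comp
      (hA.1.contDiff x₀)).differentiable (by simp) t).hasDerivAt
  have hl : l ((A' t).1 x₀) ≠ 0 := by simpa using hx₀
  have dν := dA.div dA' hl
  have hνeq : ν =ᶠ[𝓝 t] fun s => l ((A s).1 x₀) / l ((A' s).1 x₀) := by
    filter_upwards [dA'.continuousAt.eventually_ne hl] with s hs
    have : (A s).1 x₀ = ν s • (A' s).1 x₀ := by
      conv_lhs => rw [hν s]
      rfl
    rw [this, map_smul, smul_eq_mul, mul_div_cancel_right₀ _ hs]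
  have dν' := dν.congr_of_eventuallyEq hνeq
  set ν' := (deriv (fun s => l ((A s).1 x₀)) t * l ((A' t).1 x₀) -
    l ((A t).1 x₀) * l (B'.1 x₀)) / l ((A' t).1 x₀) ^ 2
  -- Product rule for A = ν A'. The second term lies in the line and dies in the quotient.
  refine ⟨ν t • B' + ν' • A' t, fun x => ?_, fun v hv => ?_⟩
  · have h1 := dν'.smul (hB' x)
    have h2 : (fun s => (A s).1 x) = fun s => ν s • (A' s).1 x := by
      ext s
      conv_lhs => rw [hν s]
      rfl
    rw [h2]
    exact h1
  · have hmem : A' t ∈ (γ t).submodule := by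
      rw [hmk]; exact (mem_submodule_iff hne).2 ⟨1, (one_smul _ _).symm⟩
    have h1 : v = ν t • ⟨A' t, hmem⟩ := Subtype.ext (hv.trans (hν t))
    rw [h1, map_smul, hξ ⟨A' t, hmem⟩ rfl, map_add, map_smul, map_smul]
    have h2 : (γ t).submodule.mkQ (A' t) = 0 := (Submodule.Quotient.mk_eq_zero _).2 hmem
    rw [h2, smul_zero, add_zero]

theorem HasVelocity.unique {γ : ℝ → PΓ I L} {t : ℝ} {p : PΓ I L} {ξ ζ : TangentPΓ p}
    (h : HasVelocity γ t p ξ) (h' : HasVelocity γ t p ζ) : ξ = ζ := by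
  obtain ⟨rfl, A, hA, B, hB, hξ⟩ := h
  obtain ⟨B', hB', hζ⟩ := h'.exists_of_lift hA
  have : B = B' := Subtype.ext (funext fun x => (hB x).unique (hB' x))
  subst this
  obtain ⟨hne, hmk⟩ := hA.2 t
  exact tangent_ext hmk fun v hv => (hξ v hv).trans (hζ v hv).symm

/-! ### The action of the phase changes -/

theorem mulFn_phaseFn_ne_zero {α : Γ I L} (hα : α ≠ 0) (F : C^∞⟮I, M; 𝓘(ℝ, ℝ), ℝ⟯) :
    mulFn I (phaseFn I F) α ≠ 0 := fun h =>
  hα (mulFn_phaseFn_injective I F (h.trans (map_zero _).symm))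

theorem P_mk (F : C^∞⟮I, M; 𝓘(ℝ, ℝ), ℝ⟯) {α : Γ I L} (hα : α ≠ 0) :
    P I F (Projectivization.mk ℂ α hα) =
      Projectivization.mk ℂ (mulFn I (phaseFn I F) α) (mulFn_phaseFn_ne_zero hα F) := rfl

theorem mulFn_phaseFn_apply (F : C^∞⟮I, M; 𝓘(ℝ, ℝ), ℝ⟯) (α : Γ I L) (x : M) :
    (mulFn I (phaseFn I F) α).1 x = Complex.exp (Complex.I * (F x : ℂ)) • α.1 x := rfl

theorem P_zero (p : PΓ I L) : P I 0 p = p := by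
  induction p using Projectivization.ind with | _ α hα
  rw [P_mk]
  congr 1
  ext x
  rw [mulFn_phaseFn_apply]
  simp

theorem P_add (F G : C^∞⟮I, M; 𝓘(ℝ, ℝ), ℝ⟯) (p : PΓ I L) :
    P I (F + G) p = P I F (P I G p) := by
  induction p using Projectivization.ind with | _ α hα
  rw [P_mk, P_mk, P_mk]
  congr 1
  ext x
  rw [mulFn_phaseFn_apply, mulFn_phaseFn_apply, mulFn_phaseFn_apply, smul_smul, ← Complex.exp_add]
  simp [mul_add]

/-- The orbit of `p` under the phase changes. -/
def phaseOrbit (p : PΓ I L) : Set (PΓ I L) := range fun F => P I F p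

theorem self_mem_phaseOrbit (p : PΓ I L) : p ∈ phaseOrbit p := ⟨0, P_zero p⟩

theorem phaseOrbit_eq_of_mem {p q : PΓ I L} (hq : q ∈ phaseOrbit p) :
    phaseOrbit q = phaseOrbit p := by
  obtain ⟨F, rfl⟩ := hq
  ext q
  constructor
  · rintro ⟨G, rfl⟩
    exact ⟨G + F, P_add G F p⟩
  · rintro ⟨G, rfl⟩
    exact ⟨G - F, by beta_reduce; rw [← P_add, sub_add_cancel]⟩

theorem contMDiff_phase {c : ℝ → C^∞⟮I, M; 𝓘(ℝ, ℝ), ℝ⟯} (hc : IsSmoothCurveFn c) :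
    ContMDiff (𝓘(ℝ, ℝ).prod I) 𝓘(ℝ, ℂ) ∞ (fun q : ℝ × M => phaseFn I (c q.1) q.2) := by
  have h : ContDiff ℝ ∞ (fun s : ℝ => Complex.exp (Complex.I * (s : ℂ))) :=
    (Complex.contDiff_exp (𝕜 := ℝ)).comp (contDiff_const.mul Complex.ofRealCLM.contDiff)
  exact h.contMDiff.comp hc

theorem isSmoothLift_phase {c : ℝ → C^∞⟮I, M; 𝓘(ℝ, ℝ), ℝ⟯} (hc : IsSmoothCurveFn c)
    {α : Γ I L} (hα : α ≠ 0) :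
    IsSmoothLift (fun t => P I (c t) (Projectivization.mk ℂ α hα))
      (fun t => mulFn I (phaseFn I (c t)) α) :=
  ⟨isSmoothCurveΓ_smul (contMDiff_phase hc) α, fun _ => ⟨mulFn_phaseFn_ne_zero hα _, P_mk _ hα⟩⟩

theorem hasVelocity_phase {c : ℝ → C^∞⟮I, M; 𝓘(ℝ, ℝ), ℝ⟯} (hc : IsSmoothCurveFn c)
    {F : C^∞⟮I, M; 𝓘(ℝ, ℝ), ℝ⟯} {t : ℝ} (hF : ∀ x, HasDerivAt (fun s => c s x) (F x) t)
    (p : PΓ I L) :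
    HasVelocity (fun s => P I (c s) p) t (P I (c t) p) (ΘP I F (P I (c t) p)) := by
  induction p using Projectivization.ind with | _ α hα
  refine ⟨rfl, _, isSmoothLift_phase hc hα, mulFn I (iFn I F) (mulFn I (phaseFn I (c t)) α),
    fun x => ?_, fun v hv => ?_⟩
  · have h1 : HasDerivAt (fun s => Complex.I * ((c s x : ℝ) : ℂ)) (Complex.I * (F x : ℂ)) t :=
      (hF x).ofReal_comp.const_mul _
    have h2 := (h1.cexp).smul_const (α.1 x)
    rw [mul_comm, mul_smul] at h2
    exact h2
  · simp only [ΘP, LinearMap.comp_apply, Submodule.subtype_apply]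
    rw [hv]

theorem isSmoothCurveFn_const_add_smul (F G : C^∞⟮I, M; 𝓘(ℝ, ℝ), ℝ⟯) :
    IsSmoothCurveFn (fun t : ℝ => F + t • G) :=
  (F.contMDiff.comp contMDiff_snd).add
    (contMDiff_fst.smul (G.contMDiff.comp contMDiff_snd))

theorem hasDerivAt_const_add_smul (F G : C^∞⟮I, M; 𝓘(ℝ, ℝ), ℝ⟯) (t : ℝ) (x : M) :
    HasDerivAt (fun s : ℝ => (F + s • G) x) (G x) t := by
  have := ((hasDerivAt_id t).mul_const (G x)).const_add (F x)
  simpa using this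

theorem hasVelocity_smul (F : C^∞⟮I, M; 𝓘(ℝ, ℝ), ℝ⟯) (p : PΓ I L) (t : ℝ) :
    HasVelocity (fun s : ℝ => P I (s • F) p) t (P I (t • F) p) (ΘP I F (P I (t • F) p)) := by
  have h := hasVelocity_phase (isSmoothCurveFn_const_add_smul 0 F)
    (fun x => hasDerivAt_const_add_smul 0 F t x) p
  beta_reduce at h
  rw [zero_add] at h
  simpa only [zero_add] using h

theorem ΘP_add (F G : C^∞⟮I, M; 𝓘(ℝ, ℝ), ℝ⟯) (p : PΓ I L) : ΘP I (F + G) p = ΘP I F p + ΘP I G p := by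
  have h : mulFn I (iFn I (F + G)) = (mulFn I (iFn I F) + mulFn I (iFn I G) : Γ I L →ₗ[ℂ] Γ I L) := by
    ext α x
    change (Complex.I * ((F x + G x : ℝ) : ℂ)) • α.1 x =
      (Complex.I * (F x : ℂ)) • α.1 x + (Complex.I * (G x : ℂ)) • α.1 x
    rw [← add_smul]; push_cast; ring_nf
  simp only [ΘP, h, LinearMap.add_comp, LinearMap.comp_add]

theorem ΘP_smul (c : ℝ) (F : C^∞⟮I, M; 𝓘(ℝ, ℝ), ℝ⟯) (p : PΓ I L) :
    ΘP I (c • F) p = c • ΘP I F p := by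
  have h : mulFn I (iFn I (c • F)) = ((c : ℂ) • mulFn I (iFn I F) : Γ I L →ₗ[ℂ] Γ I L) := by
    ext α x
    change (Complex.I * ((c * F x : ℝ) : ℂ)) • α.1 x = (c : ℂ) • (Complex.I * (F x : ℂ)) • α.1 x
    rw [smul_smul]; push_cast; ring_nf
  simp only [ΘP, h, LinearMap.smul_comp, LinearMap.comp_smul]
  rfl

/-- F ↦ Θ_P(F) is real linear, so its range is already a subspace. -/
theorem mem_phaseDistribution_iff {p : PΓ I L} {ξ : TangentPΓ p} :
    ξ ∈ phaseDistribution p ↔ ∃ F, ΘP I F p = ξ := by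
  let Θ : C^∞⟮I, M; 𝓘(ℝ, ℝ), ℝ⟯ →ₗ[ℝ] TangentPΓ p :=
    { toFun := fun F => ΘP I F p
      map_add' := fun F G => ΘP_add F G p
      map_smul' := fun c F => ΘP_smul c F p }
  have h : phaseDistribution p = LinearMap.range Θ := by
    rw [phaseDistribution]
    exact (congrArg _ (LinearMap.coe_range Θ).symm).trans (Submodule.span_eq _)
  rw [h]; rfl

/-- The parametrization is the orbit map. Straight lines F + tG realize every vector of the
distribution; conversely the velocity along a smooth curve c is Θ_P(c'(0)), since velocities are
unique. -/
theorem isIntegralManifold_phaseOrbit [I.Boundaryless] [IsManifold I ∞ M] (p : PΓ I L) :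
    IsIntegralManifold (phaseOrbit p) := by
  refine ⟨fun F => P I F p, rfl, fun c hc => ?_, fun F ξ => ⟨fun hξ => ?_, ?_⟩⟩
  · induction p using Projectivization.ind with | _ α hα
    exact ⟨_, isSmoothLift_phase hc hα⟩
  · obtain ⟨G, rfl⟩ := mem_phaseDistribution_iff.1 hξ
    refine ⟨fun t => F + t • G, isSmoothCurveFn_const_add_smul F G, by simp, ?_⟩
    have h := hasVelocity_phase (isSmoothCurveFn_const_add_smul F G)
      (fun x => hasDerivAt_const_add_smul F G 0 x) p
    beta_reduce at h
    rwa [zero_smul, add_zero] at h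
  · rintro ⟨c, hc, rfl, hv⟩
    let G : C^∞⟮I, M; 𝓘(ℝ, ℝ), ℝ⟯ := ⟨fun x => deriv (fun s => c s x) 0, contMDiff_deriv_left hc 0⟩
    have hG : ∀ x, HasDerivAt (fun s => c s x) (G x) 0 := fun x =>
      ((contDiff_curry_left hc x).differentiable (by simp) 0).hasDerivAt
    exact mem_phaseDistribution_iff.2 ⟨G, (hasVelocity_phase hc hG p).unique hv⟩

theorem phaseOrbit_subset_reachable (p : PΓ I L) : phaseOrbit p ⊆ reachable p := by
  rintro _ ⟨F, rfl⟩
  refine ⟨fun t => P I (t • F) p, fun _ => F, F.contMDiff.comp contMDiff_snd, ?_, ?_,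
    fun t _ => hasVelocity_smul F p t⟩
  · simp [P_zero]
  · simp

end Curves

end PhaseChange

namespace PhaseChange

open Set

/-! ### A scalar linear differential equation. -/

section ScalarODE

/-- A solution of `a' = (i f + μ) a` on `[0, 1]`. -/
theorem eq_exp_mul_of_hasDerivAt {a : ℝ → ℂ} {f : ℝ → ℝ} {μ : ℝ → ℂ} (hf : Continuous f)
    (hμ : ContinuousOn μ (Icc 0 1))
    (ha : ∀ t ∈ Icc (0 : ℝ) 1, HasDerivAt a ((Complex.I * (f t : ℂ) + μ t) * a t) t) :
    a 1 = Complex.exp (∫ t in (0 : ℝ)..1, IccExtend zero_le_one ((Icc 0 1).domRestrict μ) t) *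
      (Complex.exp (Complex.I * ((∫ t in (0 : ℝ)..1, f t : ℝ) : ℂ)) * a 0) := by
  -- `μ` is continuous only on [0, 1]; its extension by the end values is continuous everywhere, so
  -- the primitive is differentiable also at the end points.
  set ν : ℝ → ℂ := IccExtend zero_le_one ((Icc 0 1).domRestrict μ) with hν
  have cν : Continuous ν := hμ.domRestrict.Icc_extend'
  have hνμ : ∀ t ∈ Icc (0 : ℝ) 1, ν t = μ t := fun t ht => by
    rw [hν, IccExtend_of_mem _ _ ht]; rfl
  set Φ : ℝ → ℝ := fun t => ∫ s in (0 : ℝ)..t, f s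
  set m : ℝ → ℂ := fun t => ∫ s in (0 : ℝ)..t, ν s
  have dΦ : ∀ t, HasDerivAt Φ (f t) t := fun t =>
    intervalIntegral.integral_hasDerivAt_right (hf.intervalIntegrable _ _)
      hf.aestronglyMeasurable.stronglyMeasurableAtFilter hf.continuousAt
  have dm : ∀ t, HasDerivAt m (ν t) t := fun t =>
    intervalIntegral.integral_hasDerivAt_right (cν.intervalIntegrable _ _)
      cν.aestronglyMeasurable.stronglyMeasurableAtFilter cν.continuousAt
  -- Integrating factor: a divided by the expected solution has derivative zero.
  have key : ∀ t ∈ Icc (0 : ℝ) 1,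
      HasDerivAt (fun t => Complex.exp (-(m t + Complex.I * (Φ t : ℂ))) * a t) 0 t := by
    intro t ht
    have h1 := (((dm t).add ((dΦ t).ofReal_comp.const_mul Complex.I)).neg).cexp.mul (ha t ht)
    refine HasDerivAt.congr_deriv h1 ?_
    simp only [Pi.neg_apply, Pi.add_apply]
    rw [hνμ t ht]
    ring
  have hconst := constant_of_has_deriv_right_zero
    (fun t ht => (key t ht).continuousAt.continuousWithinAt)
    (fun t ht => (key t (Ico_subset_Icc_self ht)).hasDerivWithinAt) 1 (right_mem_Icc.2 zero_le_one)
  have h0 : m 0 = 0 := intervalIntegral.integral_same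
  have h0' : Φ 0 = 0 := intervalIntegral.integral_same
  simp only [h0, h0', Complex.ofReal_zero, mul_zero, add_zero, neg_zero, Complex.exp_zero,
    one_mul] at hconst
  rw [← hconst, ← mul_assoc, ← mul_assoc, ← Complex.exp_add, ← Complex.exp_add]
  have : m 1 + Complex.I * (Φ 1 : ℂ) + -(m 1 + Complex.I * (Φ 1 : ℂ)) = 0 := by ring
  change a 1 = Complex.exp (m 1 + Complex.I * (Φ 1 : ℂ) + -(m 1 + Complex.I * (Φ 1 : ℂ))) * a 1
  rw [this, Complex.exp_zero, one_mul]

end ScalarODE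

/-! ### Leaves are orbits. -/

section Leaves

variable {E : Type*} [NormedAddCommGroup E] [NormedSpace ℝ E]
  {H : Type*} [TopologicalSpace H] {I : ModelWithCorners ℝ E H}
  {M : Type*} [TopologicalSpace M] [ChartedSpace H M]
  {L : M → Type*} [∀ x, NormedAddCommGroup (L x)] [∀ x, InnerProductSpace ℂ (L x)]
  [TopologicalSpace (TotalSpace ℂ L)] [FiberBundle ℂ L]
  [VectorBundle ℂ ℂ L] [VectorBundle ℝ ℂ L]

/-- The velocity determines the derivative of a lift only modulo the line, hence the multiple μ of
`A t`. One scalar serves all points x. -/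
theorem HasVelocity.exists_hasDerivAt {γ : ℝ → PΓ I L} {t : ℝ} {F : C^∞⟮I, M; 𝓘(ℝ, ℝ), ℝ⟯}
    (h : HasVelocity γ t (γ t) (ΘP I F (γ t))) {A : ℝ → Γ I L} (hA : IsSmoothLift γ A) :
    ∃ μ : ℂ, ∀ x, HasDerivAt (fun s => (A s).1 x)
      ((Complex.I * (F x : ℂ) + μ) • (A t).1 x) t := by
  obtain ⟨B, hB, hξ⟩ := h.exists_of_lift hA
  obtain ⟨hne, hmk⟩ := hA.2 t
  have hmem : A t ∈ (γ t).submodule := by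
    rw [hmk]; exact (mem_submodule_iff hne).2 ⟨1, (one_smul _ _).symm⟩
  have h1 := hξ ⟨A t, hmem⟩ rfl
  have h2 : B - mulFn I (iFn I F) (A t) ∈ (γ t).submodule :=
    (Submodule.Quotient.eq _).1 h1.symm
  rw [hmk] at h2
  obtain ⟨μ, hμ⟩ := (mem_submodule_iff hne).1 h2
  refine ⟨μ, fun x => ?_⟩
  have h3 : B.1 x = (Complex.I * (F x : ℂ) + μ) • (A t).1 x := by
    have h4 : B = mulFn I (iFn I F) (A t) + μ • A t := by rw [← hμ]; abel
    rw [h4, add_smul]; rfl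
  rw [← h3]
  exact hB x

/-- At every x the lift solves a scalar linear equation. The term μ contributes a factor that is the
same for all x and disappears projectively; F contributes the phase ∫ F_t(x) dt. -/
theorem reachable_subset_phaseOrbit [I.Boundaryless] [IsManifold I ∞ M] (p : PΓ I L) :
    reachable p ⊆ phaseOrbit p := by
  rintro q ⟨γ, F, hF, rfl, rfl, hγ⟩
  obtain ⟨-, A, hA, -⟩ := hγ 0 (left_mem_Icc.2 zero_le_one)
  -- Outside [0, 1] the curve is unconstrained and μ gets the value 0, which plays no role.
  have hex : ∀ t, ∃ μ : ℂ, t ∈ Icc (0 : ℝ) 1 → ∀ x, HasDerivAt (fun s => (A s).1 x)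
      ((Complex.I * (F t x : ℂ) + μ) • (A t).1 x) t := fun t => by
    by_cases ht : t ∈ Icc (0 : ℝ) 1
    · obtain ⟨μ, hμ⟩ := (hγ t ht).exists_hasDerivAt hA
      exact ⟨μ, fun _ => hμ⟩
    · exact ⟨0, fun h => absurd h ht⟩
  choose μ hμ using hex
  let l : ∀ x, L x ≃L[ℂ] ℂ := fun x => (trivializationAt ℂ L x).continuousLinearEquivAt ℂ x
    (mem_baseSet_trivializationAt ℂ L x)
  have hl : ∀ t ∈ Icc (0 : ℝ) 1, ∀ x, HasDerivAt (fun s => l x ((A s).1 x))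
      ((Complex.I * (F t x : ℂ) + μ t) * l x ((A t).1 x)) t := fun t ht x => by
    have := ((l x : L x →L[ℂ] ℂ).restrictScalars ℝ).hasFDerivAt.comp_hasDerivAt t (hμ t ht x)
    simp only [ContinuousLinearMap.coe_restrictScalars', ContinuousLinearEquiv.coe_coe, map_smul,
      smul_eq_mul] at this
    exact this
  have hsm : ∀ x, ContDiff ℝ ∞ (fun s => l x ((A s).1 x)) := fun x =>
    ((l x : L x →L[ℂ] ℂ).restrictScalars ℝ).contDiff.comp (hA.1.contDiff x)
  have hFc : ∀ x, Continuous fun t => F t x := fun x => (contDiff_curry_left hF x).continuous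
  -- Solving the equation for μ at a point x with `A t` nonzero at x expresses it near t by
  -- continuous functions; x may depend on t.
  have hμc : ContinuousOn μ (Icc 0 1) := by
    intro t ht
    obtain ⟨hne, -⟩ := hA.2 t
    obtain ⟨x, hx⟩ := exists_ne_zero hne
    have hx' : l x ((A t).1 x) ≠ 0 := by simpa using hx
    have h1 : ContinuousAt (fun s => deriv (fun s => l x ((A s).1 x)) s / l x ((A s).1 x) -
        Complex.I * (F s x : ℂ)) t :=
      (((hsm x).continuous_deriv (by simp)).continuousAt.div (hsm x).continuous.continuousAt
        hx').sub (continuousAt_const.mul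
          (Complex.continuous_ofReal.comp (hFc x)).continuousAt)
    have h2 : ∀ s ∈ Icc (0 : ℝ) 1, l x ((A s).1 x) ≠ 0 →
        μ s = deriv (fun s => l x ((A s).1 x)) s / l x ((A s).1 x) - Complex.I * (F s x : ℂ) := by
      intro s hs h0
      rw [(hl s hs x).deriv, mul_div_cancel_right₀ _ h0]
      ring
    refine h1.continuousWithinAt.congr_of_eventuallyEq ?_ (h2 t ht hx')
    filter_upwards [self_mem_nhdsWithin,
      nhdsWithin_le_nhds ((hsm x).continuous.continuousAt.eventually_ne hx')] with s hs h0
    exact h2 s hs h0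
  let G : C^∞⟮I, M; 𝓘(ℝ, ℝ), ℝ⟯ := ⟨fun x => ∫ t in (0 : ℝ)..1, F t x,
    contMDiff_intervalIntegral hF⟩
  obtain ⟨h0, e0⟩ := hA.2 0
  obtain ⟨h1, e1⟩ := hA.2 1
  refine ⟨G, ?_⟩
  beta_reduce
  rw [e0, e1, P_mk]
  refine (mk_eq_of_smul (mulFn_phaseFn_ne_zero h0 G) h1 (c := Complex.exp (∫ t in (0 : ℝ)..1,
    IccExtend zero_le_one ((Icc 0 1).domRestrict μ) t)) ?_).symm
  ext x
  refine (l x).injective ?_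
  rw [eq_exp_mul_of_hasDerivAt (a := fun s => l x ((A s).1 x)) (hFc x) hμc fun t ht => hl t ht x]
  have h2 : (Complex.exp (∫ t in (0 : ℝ)..1, IccExtend zero_le_one ((Icc 0 1).domRestrict μ) t) •
      mulFn I (phaseFn I G) (A 0)).1 x =
      Complex.exp (∫ t in (0 : ℝ)..1, IccExtend zero_le_one ((Icc 0 1).domRestrict μ) t) •
      Complex.exp (Complex.I * ((∫ t in (0 : ℝ)..1, F t x : ℝ) : ℂ)) • (A 0).1 x := rfl
  rw [h2, map_smul, map_smul, smul_eq_mul, smul_eq_mul]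

theorem reachable_eq_phaseOrbit [I.Boundaryless] [IsManifold I ∞ M] (p : PΓ I L) :
    reachable p = phaseOrbit p :=
  (reachable_subset_phaseOrbit p).antisymm (phaseOrbit_subset_reachable p)

theorem isLeaf_phaseOrbit [I.Boundaryless] [IsManifold I ∞ M] (p : PΓ I L) :
    IsLeaf (phaseOrbit p) :=
  ⟨⟨p, self_mem_phaseOrbit p⟩, isIntegralManifold_phaseOrbit p, fun q hq => by
    rw [reachable_eq_phaseOrbit, phaseOrbit_eq_of_mem hq]⟩

theorem IsLeaf.eq_phaseOrbit [I.Boundaryless] [IsManifold I ∞ M] {N : Set (PΓ I L)}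
    (hN : IsLeaf N) {p : PΓ I L} (hp : p ∈ N) : N = phaseOrbit p := by
  rw [← hN.2.2 p hp, reachable_eq_phaseOrbit]

end Leaves

end PhaseChange

namespace PhaseChange

open Set

/-! ### Differentials of functions on M. -/

section Derivatives

variable {E : Type*} [NormedAddCommGroup E] [NormedSpace ℝ E]
  {H : Type*} [TopologicalSpace H] {I : ModelWithCorners ℝ E H}
  {M : Type*} [TopologicalSpace M] [ChartedSpace H M]
  {V : Type*} [NormedAddCommGroup V] [NormedSpace ℝ V]
  {W : Type*} [NormedAddCommGroup W] [NormedSpace ℝ W]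

theorem mvfderiv_comp_left {F : M → V} {φ : V → W} {x : M} (hφ : DifferentiableAt ℝ φ (F x))
    (hF : MDifferentiableAt I 𝓘(ℝ, V) F x) (v : TangentSpace I x) :
    mvfderiv I (fun y => φ (F y)) x v = fderiv ℝ φ (F x) (mvfderiv I F x v) := by
  have h : mfderiv I 𝓘(ℝ, W) (φ ∘ F) x = _ := mfderiv_comp x hφ.mdifferentiableAt hF
  rw [mfderiv_eq_fderiv] at h
  exact congrArg (fun A => A v) h

theorem mvfderiv_congr {f g : M → V} {x : M} (h : f =ᶠ[𝓝 x] g) (v : TangentSpace I x) :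
    mvfderiv I f x v = mvfderiv I g x v := by
  have h1 : mfderiv I 𝓘(ℝ, V) f x = mfderiv I 𝓘(ℝ, V) g x := h.mfderiv_eq
  exact congrArg (fun A => A v) h1

theorem mvfderiv_mul_of_eq_zero {u g : M → ℂ} {x : M} (hu : MDifferentiableAt I 𝓘(ℝ, ℂ) u x)
    (hg : MDifferentiableAt I 𝓘(ℝ, ℂ) g x) (h0 : g x = 0) (v : TangentSpace I x) :
    mvfderiv I (fun y => u y * g y) x v = u x * mvfderiv I g x v := by
  have h : HasMFDerivAt I 𝓘(ℝ, ℂ) (u * g) x _ := hu.hasMFDerivAt.mul' hg.hasMFDerivAt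
  have h1 := congrArg (fun A => A v) h.mfderiv
  refine h1.trans ?_
  change u x * mvfderiv I g x v + mvfderiv I u x v * g x = _
  rw [h0, mul_zero, add_zero]

/-- A smooth function whose differential vanishes on a dense set has zero differential. -/
theorem mvfderiv_eq_zero_of_dense [I.Boundaryless] [IsManifold I ∞ M] {f : M → V}
    (hf : ContMDiff I 𝓘(ℝ, V) ∞ f) {S : Set M} (hS : Dense S)
    (h : ∀ x ∈ S, mvfderiv I f x = 0) (p : M) : mvfderiv I f p = 0 := by
  -- Read in the fixed chart at p, the differentials lie in one space of linear maps and depend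
  -- continuously on x, so the value 0 passes from S to p.
  have hc : ContinuousAt (fun x => fderiv ℝ (f ∘ (extChartAt I p).symm) (extChartAt I p x)) p := by
    have h1 : ContDiffAt ℝ ∞ (f ∘ (extChartAt I p).symm) (extChartAt I p p) :=
      ContMDiffAt.contDiffAt_comp_extChartAt_symm (mem_extChartAt_target p) (hf _)
    exact ContinuousAt.comp (g := fderiv ℝ (f ∘ (extChartAt I p).symm))
      ((h1.fderiv_right (m := 0) (by simp)).continuousAt) (continuousAt_extChartAt p)
  have : (𝓝[S] p).NeBot := mem_closure_iff_nhdsWithin_neBot.1 (hS p)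
  have h0 : (fun x => fderiv ℝ (f ∘ (extChartAt I p).symm) (extChartAt I p x)) =ᶠ[𝓝[S] p]
      fun _ => 0 := by
    filter_upwards [self_mem_nhdsWithin,
      nhdsWithin_le_nhds (extChartAt_source_mem_nhds (I := I) p)] with x hxS hx
    ext v
    have hx' := (extChartAt I p).map_source hx
    rw [fderiv_comp_extChartAt_symm hx' ((hf _).mdifferentiableAt (by simp)), h]
    · rfl
    · rwa [(extChartAt I p).left_inv hx]
  have hz := tendsto_nhds_unique_of_eventuallyEq (hc.tendsto.mono_left nhdsWithin_le_nhds)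
    tendsto_const_nhds h0
  ext v
  have hv := fderiv_comp_extChartAt_symm_self ((hf p).mdifferentiableAt (by simp)) v
  rw [hz] at hv
  exact hv.symm

end Derivatives

/-! ### Zero divisors. -/

section Divisors

variable {E : Type*} [NormedAddCommGroup E] [NormedSpace ℝ E]
  {H : Type*} [TopologicalSpace H] {I : ModelWithCorners ℝ E H}
  {M : Type*} [TopologicalSpace M] [ChartedSpace H M]
  {L : M → Type*} [∀ x, NormedAddCommGroup (L x)] [∀ x, InnerProductSpace ℂ (L x)]
  [TopologicalSpace (TotalSpace ℂ L)] [FiberBundle ℂ L]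
  [VectorBundle ℂ ℂ L] [VectorBundle ℝ ℂ L]

theorem localFn_eq_zero_iff {α : Γ I L} {p x : M} (hx : x ∈ (trivializationAt ℂ L p).baseSet) :
    localFn α p x = 0 ↔ α.1 x = 0 :=
  ((trivializationAt ℂ L p).continuousLinearEquivAt ℂ x hx).map_eq_zero_iff

theorem localFn_smul {α β : Γ I L} {p x : M} (hx : x ∈ (trivializationAt ℂ L p).baseSet) {c : ℂ}
    (h : β.1 x = c • α.1 x) : localFn β p x = c * localFn α p x := by
  have := ((trivializationAt ℂ L p).continuousLinearEquivAt ℂ x hx).map_smul c (α.1 x)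
  rw [← h] at this
  exact this

theorem eq_smul_of_localFn {α β : Γ I L} {p x : M}
    (hx : x ∈ (trivializationAt ℂ L p).baseSet) {c : ℂ}
    (h : localFn β p x = c * localFn α p x) : β.1 x = c • α.1 x := by
  refine ((trivializationAt ℂ L p).continuousLinearEquivAt ℂ x hx).injective ?_
  rw [map_smul]
  exact h

theorem contMDiffOn_localFn [ContMDiffVectorBundle ∞ ℂ L I] (α : Γ I L) (p : M) :
    ContMDiffOn I 𝓘(ℝ, ℂ) ∞ (localFn α p) (trivializationAt ℂ L p).baseSet :=
  ((trivializationAt ℂ L p).contMDiffOn_section_iff (trivializationAt ℂ L p).open_baseSet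
    subset_rfl).1 (ContMDiff.contMDiffOn α.2)

theorem localFn_mem_zeroDivisor (α : Γ I L) (p : M) : localFn α p ∈ zeroDivisor α p :=
  Or.inl ⟨univ, fun _ => 1, isOpen_univ, mem_univ p, contMDiffOn_const, fun _ _ =>
    ⟨one_ne_zero, (one_mul _).symm⟩⟩

theorem SameZerosAt.eq_zero_iff {p : M} {f g : M → ℂ} (h : SameZerosAt I p f g) :
    f p = 0 ↔ g p = 0 := by
  rcases h with ⟨U, u, -, hp, -, h⟩ | ⟨U, -, hp, -, -, -, h, -⟩
  · rw [(h p hp).2, mul_eq_zero, or_iff_right (h p hp).1]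
  · exact h p hp

/-- The local function of α at x is one of the equations of its divisor, and all the others vanish
at x exactly when it does. -/
theorem mem_divisorSupport_zeroDivisor {α : Γ I L} {x : M} :
    x ∈ divisorSupport (zeroDivisor α) ↔ α.1 x = 0 := by
  rw [← localFn_eq_zero_iff (mem_baseSet_trivializationAt ℂ L x)]
  exact ⟨fun h => h _ (localFn_mem_zeroDivisor α x), fun h f hf =>
    (SameZerosAt.eq_zero_iff hf).2 h⟩

theorem compl_divisorSupport_zeroDivisor (α : Γ I L) :
    (divisorSupport (zeroDivisor α))ᶜ = {x | α.1 x ≠ 0} := by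
  ext x
  exact not_congr mem_divisorSupport_zeroDivisor

/-- In the first alternative u⁻¹ is absorbed into the factor. At a regular zero the derivative of ug
is u(p) dg, and multiplication by u(p)⁻¹ has determinant |u(p)⁻¹|² > 0, so the orientation is kept.
-/
theorem SameZerosAt.mul_right {p : M} {f g k u : M → ℂ} (h : SameZerosAt I p f g)
    (hg : ∀ᶠ x in 𝓝 p, ContMDiffAt I 𝓘(ℝ, ℂ) ∞ g x)
    (hu : ContMDiff I 𝓘(ℝ, ℂ) ∞ u) (hu0 : ∀ x, u x ≠ 0)
    (hk : ∀ᶠ x in 𝓝 p, k x = u x * g x) : SameZerosAt I p f k := by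
  obtain ⟨O, hO, hOo, hpO⟩ := eventually_nhds_iff.1 (hk.and hg)
  rcases h with ⟨U, w, hU, hp, hw, h⟩ | ⟨U, hU, hp, hfs, hgs, hf0, hz, hfsurj, hgsurj, T, hT, hfg⟩
  · refine Or.inl ⟨U ∩ O, fun x => w x * (u x)⁻¹, hU.inter hOo, ⟨hp, hpO⟩, ?_, ?_⟩
    · intro x hx
      refine ContMDiffAt.contMDiffWithinAt ?_
      have h1 : ContDiffAt ℝ ∞ (fun z : ℂ × ℂ => z.1 * z.2⁻¹) (w x, u x) :=
        contDiffAt_fst.mul (contDiffAt_snd.inv (hu0 x))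
      exact h1.contMDiffAt.comp x (f := fun y => (w y, u y))
        ((hw.contMDiffAt (hU.mem_nhds hx.1)).prodMk_space (hu x))
    · rintro x ⟨hxU, hxO⟩
      refine ⟨mul_ne_zero (h x hxU).1 (inv_ne_zero (hu0 x)), ?_⟩
      rw [(h x hxU).2, (hO x hxO).1, mul_assoc, inv_mul_cancel_left₀ (hu0 x)]
  · have hg0 : g p = 0 := (hz p hp).1 hf0
    have hkd : ∀ v, mvfderiv I k p v = u p * mvfderiv I g p v := fun v => by
      rw [mvfderiv_congr hk v]
      exact mvfderiv_mul_of_eq_zero ((hu p).mdifferentiableAt (by simp))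
        ((hO p hpO).2.mdifferentiableAt (by simp)) hg0 v
    refine Or.inr ⟨U ∩ O, hU.inter hOo, ⟨hp, hpO⟩, hfs.mono inter_subset_left, ?_, hf0, ?_,
      hfsurj, ?_, T ∘ₗ LinearMap.mulLeft ℝ (u p)⁻¹, ?_, ?_⟩
    · intro x hx
      have h1 : ContDiff ℝ ∞ (fun z : ℂ × ℂ => z.1 * z.2) := contDiff_fst.mul contDiff_snd
      have h2 : ContMDiffAt I 𝓘(ℝ, ℂ) ∞ (fun y => u y * g y) x :=
        h1.contMDiff.contMDiffAt.comp x (f := fun y => (u y, g y))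
          ((hu x).prodMk_space (hO x hx.2).2)
      refine (h2.congr_of_eventuallyEq ?_).contMDiffWithinAt
      filter_upwards [hOo.mem_nhds hx.2] with y hy using (hO y hy).1
    · rintro x ⟨hxU, hxO⟩
      rw [(hO x hxO).1, mul_eq_zero, or_iff_right (hu0 x)]
      exact hz x hxU
    · intro c
      obtain ⟨v, hv⟩ := hgsurj ((u p)⁻¹ * c)
      exact ⟨v, by rw [hkd, hv, mul_inv_cancel_left₀ (hu0 p)]⟩
    · rw [LinearMap.det_comp]
      refine mul_pos hT ?_
      rw [LinearMap.det_complex]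
      have h1 : 0 < Complex.normSq (u p)⁻¹ := Complex.normSq_pos.2 (inv_ne_zero (hu0 p))
      rw [Complex.normSq_apply] at h1
      simp only [LinearMap.mulLeft_apply, mul_one, Complex.mul_re, Complex.mul_im, Complex.I_re,
        Complex.I_im, mul_zero, zero_sub, add_zero]
      nlinarith
    · intro v
      rw [LinearMap.comp_apply, LinearMap.mulLeft_apply, hkd, inv_mul_cancel_left₀ (hu0 p)]
      exact hfg v

theorem zeroDivisor_subset_of_smul [IsManifold I ∞ M] [ContMDiffVectorBundle ∞ ℂ L I]
    {α β : Γ I L} {u : M → ℂ}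
    (hu : ContMDiff I 𝓘(ℝ, ℂ) ∞ u) (hu0 : ∀ x, u x ≠ 0) (h : ∀ x, β.1 x = u x • α.1 x) (p : M) :
    zeroDivisor α p ⊆ zeroDivisor β p := by
  intro f hf
  have hb := (trivializationAt ℂ L p).open_baseSet
  have hmem := hb.mem_nhds (mem_baseSet_trivializationAt ℂ L p)
  refine SameZerosAt.mul_right hf ?_ hu hu0 ?_
  · filter_upwards [hmem] with x hx
    exact (contMDiffOn_localFn α p).contMDiffAt (hb.mem_nhds hx)
  · filter_upwards [hmem] with x hx using localFn_smul hx (h x)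

theorem zeroDivisor_eq_of_smul [IsManifold I ∞ M] [ContMDiffVectorBundle ∞ ℂ L I]
    {α β : Γ I L} {u : M → ℂ}
    (hu : ContMDiff I 𝓘(ℝ, ℂ) ∞ u) (hu0 : ∀ x, u x ≠ 0) (h : ∀ x, β.1 x = u x • α.1 x) :
    zeroDivisor β = zeroDivisor α := by
  funext p
  refine (zeroDivisor_subset_of_smul (u := fun x => (u x)⁻¹) ?_ (fun x => inv_ne_zero (hu0 x))
    (fun x => ?_) p).antisymm (zeroDivisor_subset_of_smul hu hu0 h p)
  · exact fun x => (contDiffAt_inv (𝕜 := ℝ) (hu0 x)).contMDiffAt.comp x (hu x)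
  · rw [h x, smul_smul, inv_mul_cancel₀ (hu0 x), one_smul]

theorem zeroDivisor_phase [IsManifold I ∞ M] [ContMDiffVectorBundle ∞ ℂ L I]
    (F : C^∞⟮I, M; 𝓘(ℝ, ℝ), ℝ⟯) (α : Γ I L) :
    zeroDivisor (mulFn I (phaseFn I F) α) = zeroDivisor α :=
  zeroDivisor_eq_of_smul (phaseFn I F).contMDiff (fun _ => Complex.exp_ne_zero _) fun _ => rfl

end Divisors

/-! ### The connection and the form ρ. -/

section Rho

variable {E : Type*} [NormedAddCommGroup E] [NormedSpace ℝ E]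
  {H : Type*} [TopologicalSpace H] {I : ModelWithCorners ℝ E H}
  {M : Type*} [TopologicalSpace M] [ChartedSpace H M] [IsManifold I ∞ M]
  {L : M → Type*} [∀ x, NormedAddCommGroup (L x)] [∀ x, InnerProductSpace ℂ (L x)]
  [TopologicalSpace (TotalSpace ℂ L)] [FiberBundle ℂ L]
  [VectorBundle ℂ ℂ L] [VectorBundle ℝ ℂ L] {a : CovariantDerivative I ℂ L}

omit [IsManifold I ∞ M] in
theorem rho_apply (α : Γ I L) (x : M) (v : TangentSpace I x) :
    rho a α x v = (inner ℂ (α.1 x) (α.1 x))⁻¹ * inner ℂ (α.1 x) (a α.1 x v) := rfl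

omit [IsManifold I ∞ M] in
-- The factor c cancels in the quotient ∇β/β. The case d = 0 covers constant factors, the case d = i
-- dF the phase changes.
theorem rho_of_smul_add {α β : Γ I L} {x : M} {v : TangentSpace I x} (hα : α.1 x ≠ 0) {c d : ℂ}
    (hc : c ≠ 0) (h : β.1 x = c • α.1 x)
    (hv : a β.1 x v = c • a α.1 x v + (c * d) • α.1 x) :
    rho a β x v = rho a α x v + d := by
  have h0 : inner ℂ (α.1 x) (α.1 x) ≠ 0 := inner_self_ne_zero.2 hα
  have hc' : (starRingEnd ℂ) c ≠ 0 := by simpa using hc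
  rw [rho_apply, rho_apply, hv, h]
  simp only [inner_smul_left, inner_smul_right, inner_add_right]
  field_simp

theorem rho_const_smul (ha : IsHermitianConnection a) {α : Γ I L} {x : M} (hα : α.1 x ≠ 0) {c : ℂ}
    (hc : c ≠ 0) : rho a (c • α) x = rho a α x := by
  ext v
  rw [rho_of_smul_add (d := 0) hα hc rfl, add_zero]
  rw [mul_zero, zero_smul, add_zero]
  exact ha.complex_linear c α.1 α.2 x v

theorem connection_phase (ha : IsHermitianConnection a) (F : C^∞⟮I, M; 𝓘(ℝ, ℝ), ℝ⟯) (α : Γ I L)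
    (x : M) (v : TangentSpace I x) :
    a (mulFn I (phaseFn I F) α).1 x v = Complex.exp (Complex.I * (F x : ℂ)) • a α.1 x v +
      (Complex.exp (Complex.I * (F x : ℂ)) * (Complex.I * ((mvfderiv I F x v : ℝ) : ℂ))) • α.1 x := by
  have hF : MDifferentiableAt I 𝓘(ℝ, ℝ) F x := F.contMDiff.mdifferentiable (by simp) x
  have md : ∀ s : Γ I L, MDifferentiableAt I (I.prod 𝓘(ℝ, ℂ))
      (fun y => TotalSpace.mk' ℂ y (s.1 y)) x := fun s =>
    (ContMDiff.contMDiffAt s.2).mdifferentiableAt (by simp)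
  have scos : ContMDiff I 𝓘(ℝ, ℝ) ∞ (fun y => Real.cos (F y)) :=
    (Real.contDiff_cos (n := ∞)).contMDiff.comp F.contMDiff
  have ssin : ContMDiff I 𝓘(ℝ, ℝ) ∞ (fun y => Real.sin (F y)) :=
    (Real.contDiff_sin (n := ∞)).contMDiff.comp F.contMDiff
  have hcos : MDifferentiableAt I 𝓘(ℝ, ℝ) (fun y => Real.cos (F y)) x :=
    scos.mdifferentiable (by simp) x
  have hsin : MDifferentiableAt I 𝓘(ℝ, ℝ) (fun y => Real.sin (F y)) x :=
    ssin.mdifferentiable (by simp) x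
  have dcos : mvfderiv I (fun y => Real.cos (F y)) x v = -Real.sin (F x) * mvfderiv I F x v := by
    rw [mvfderiv_comp_left Real.differentiableAt_cos hF,
      (Real.hasDerivAt_cos (F x)).hasFDerivAt.fderiv]
    simp [mul_comm]
  have dsin : mvfderiv I (fun y => Real.sin (F y)) x v = Real.cos (F x) * mvfderiv I F x v := by
    rw [mvfderiv_comp_left Real.differentiableAt_sin hF,
      (Real.hasDerivAt_sin (F x)).hasFDerivAt.fderiv]
    simp [mul_comm]
  -- The Leibniz rule of `a` concerns real functions, so e^{iF} is split into cos F and sin F;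
  -- complex linearity takes care of the factor i.
  have hsplit : (mulFn I (phaseFn I F) α).1 =
      (fun y => Real.cos (F y)) • α.1 + (fun y => Real.sin (F y)) • (Complex.I • α).1 := by
    funext y
    change Complex.exp (Complex.I * (F y : ℂ)) • α.1 y =
      Real.cos (F y) • α.1 y + Real.sin (F y) • Complex.I • α.1 y
    rw [mul_comm, Complex.exp_mul_I, add_smul, ← Complex.ofReal_cos, ← Complex.ofReal_sin, mul_smul]
    rfl
  have hc : ∀ (s : Γ I L) (k : M → ℝ), ContMDiff I 𝓘(ℝ, ℝ) ∞ k →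
      MDifferentiableAt I (I.prod 𝓘(ℝ, ℂ)) (fun y => TotalSpace.mk' ℂ y ((k • s.1) y)) x := by
    intro s k hk
    have h1 : ContMDiff I 𝓘(ℝ, ℂ) ∞ (fun y => (k y : ℂ)) :=
      Complex.ofRealCLM.contDiff.contMDiff.comp hk
    exact (ContMDiff.contMDiffAt (isSmoothSection_smul I h1 s.2)).mdifferentiableAt (by simp)
  have hI : a (Complex.I • α).1 x v = Complex.I • a α.1 x v := ha.complex_linear _ α.1 α.2 x v
  rw [hsplit, a.isCovariantDerivativeOnUniv.add (hc α _ scos) (hc (Complex.I • α) _ ssin),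
    a.isCovariantDerivativeOnUniv.leibniz (md α) hcos,
    a.isCovariantDerivativeOnUniv.leibniz (md _) hsin]
  have hval : (Complex.I • α).1 x = Complex.I • α.1 x := rfl
  simp only [add_apply, smul_apply, ContinuousLinearMap.smulRight_apply]
  rw [dcos, dsin, hI, hval, mul_comm Complex.I (F x : ℂ), Complex.exp_mul_I, ← Complex.ofReal_cos,
    ← Complex.ofReal_sin]
  have key : ((Real.cos (F x) : ℂ) + (Real.sin (F x) : ℂ) * Complex.I) *
      (Complex.I * ((mvfderiv I F x v : ℝ) : ℂ)) = ((-Real.sin (F x) * mvfderiv I F x v : ℝ) : ℂ) +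
        ((Real.cos (F x) * mvfderiv I F x v : ℝ) : ℂ) * Complex.I := by
    push_cast
    linear_combination (Complex.sin (F x) * ((mvfderiv I F x v : ℝ) : ℂ)) * Complex.I_sq
  rw [key]
  simp only [← Complex.coe_smul]
  module

end Rho

end PhaseChange

namespace PhaseChange

open Set

/-! ### The fibers ℙ⁰(D) are orbits. -/

section Fibers

variable {E : Type*} [NormedAddCommGroup E] [NormedSpace ℝ E]
  {H : Type*} [TopologicalSpace H] {I : ModelWithCorners ℝ E H}
  {M : Type*} [TopologicalSpace M] [ChartedSpace H M] [IsManifold I ∞ M]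
  {L : M → Type*} [∀ x, NormedAddCommGroup (L x)] [∀ x, InnerProductSpace ℂ (L x)]
  [TopologicalSpace (TotalSpace ℂ L)] [FiberBundle ℂ L]
  [VectorBundle ℂ ℂ L] [VectorBundle ℝ ℂ L] {a : CovariantDerivative I ℂ L}

theorem rho_phase (ha : IsHermitianConnection a) (F : C^∞⟮I, M; 𝓘(ℝ, ℝ), ℝ⟯) (α : Γ I L) {x : M}
    (hα : α.1 x ≠ 0) (v : TangentSpace I x) :
    rho a (mulFn I (phaseFn I F) α) x v =
      rho a α x v + Complex.I * ((dFn I M F x v : ℝ) : ℂ) :=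
  rho_of_smul_add hα (Complex.exp_ne_zero _) (mulFn_phaseFn_apply F α x)
    (connection_phase ha F α x v)

theorem reRho_phase (ha : IsHermitianConnection a) (F : C^∞⟮I, M; 𝓘(ℝ, ℝ), ℝ⟯) (α : Γ I L) {x : M}
    (hα : α.1 x ≠ 0) : reRho a (mulFn I (phaseFn I F) α) x = reRho a α x := by
  ext v
  have h := congrArg Complex.re (rho_phase ha F α hα v)
  rw [Complex.add_re, Complex.I_mul_re, Complex.ofReal_im, neg_zero, add_zero] at h
  exact h

omit [IsManifold I ∞ M] in
theorem contMDiff_norm_sq (hL : IsSmoothHermitian I L)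
    (α : Γ I L) : ContMDiff I 𝓘(ℝ, ℝ) ∞ (fun x => ‖α.1 x‖ ^ 2) := by
  refine (Complex.reCLM.contDiff.contMDiff.comp (hL α.1 α.1 α.2 α.2)).congr fun x => ?_
  exact (inner_self_eq_norm_sq (𝕜 := ℂ) (α.1 x)).symm

/-- For a hermitian connection d⟨α, α⟩ = 2 Re⟨α, ∇α⟩. Thus Re ρ(α) is the logarithmic derivative of
|α|, and prescribing it fixes |α| up to local constants. -/
theorem mvfderiv_norm_sq (hL : IsSmoothHermitian I L) (ha : IsHermitianConnection a) {α : Γ I L}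
    {x : M} (hα : α.1 x ≠ 0) (v : TangentSpace I x) :
    mvfderiv I (fun y => ‖α.1 y‖ ^ 2) x v = 2 * ‖α.1 x‖ ^ 2 * reRho a α x v := by
  have h1 : (fun y => ‖α.1 y‖ ^ 2) = fun y => Complex.reCLM (inner ℂ (α.1 y) (α.1 y)) := by
    funext y
    exact (inner_self_eq_norm_sq (𝕜 := ℂ) (α.1 y)).symm
  have h2 : MDifferentiableAt I 𝓘(ℝ, ℂ) (fun y => inner ℂ (α.1 y) (α.1 y)) x :=
    (hL α.1 α.1 α.2 α.2).mdifferentiable (by simp) x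
  rw [h1, mvfderiv_comp_left Complex.reCLM.differentiableAt h2, ContinuousLinearMap.fderiv,
    ha.hermitian α.1 α.1 α.2 α.2 x v]
  have h3 : reRho a α x v = ((inner ℂ (α.1 x) (α.1 x))⁻¹ * inner ℂ (α.1 x) (a α.1 x v)).re := rfl
  have hn : ‖α.1 x‖ ^ 2 ≠ 0 := pow_ne_zero 2 (norm_ne_zero_iff.2 hα)
  have h4 : (inner ℂ (α.1 x) (α.1 x) : ℂ) = ((‖α.1 x‖ ^ 2 : ℝ) : ℂ) := by
    rw [inner_self_eq_norm_sq_to_K]; push_cast; rfl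
  rw [h3, h4, ← Complex.ofReal_inv, Complex.re_ofReal_mul, Complex.reCLM_apply, Complex.add_re,
    ← inner_conj_symm (a α.1 x v) (α.1 x), Complex.conj_re]
  field_simp
  ring

/-- The quotient of the norms of two sections with the same real part of `ρ` is locally
constant. -/
theorem eventually_norm_div_eq [I.Boundaryless] (hL : IsSmoothHermitian I L)
    (ha : IsHermitianConnection a) {α β : Γ I L} (hz : ∀ x, β.1 x = 0 ↔ α.1 x = 0)
    (hρ : ∀ x, α.1 x ≠ 0 → reRho a β x = reRho a α x) {x : M} (hx : α.1 x ≠ 0) :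
    ∀ᶠ y in 𝓝 x, ‖β.1 y‖ / ‖α.1 y‖ = ‖β.1 x‖ / ‖α.1 x‖ := by
  have hU : IsOpen {y | α.1 y ≠ 0} := by
    have : {y | α.1 y ≠ 0} = (fun y => ‖α.1 y‖ ^ 2) ⁻¹' {0}ᶜ := by ext y; simp
    rw [this]
    exact isOpen_compl_singleton.preimage (contMDiff_norm_sq hL α).continuous
  have hα2 : ∀ y, α.1 y ≠ 0 → ‖α.1 y‖ ^ 2 ≠ 0 := fun y hy => pow_ne_zero 2 (norm_ne_zero_iff.2 hy)
  have hq : ∀ y ∈ {y | α.1 y ≠ 0}, MDifferentiableAt I 𝓘(ℝ, ℝ)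
      (fun y => ‖β.1 y‖ ^ 2 / ‖α.1 y‖ ^ 2) y := fun y hy => by
    have h1 : ContDiffAt ℝ ∞ (fun z : ℝ × ℝ => z.1 / z.2) (‖β.1 y‖ ^ 2, ‖α.1 y‖ ^ 2) :=
      contDiffAt_fst.div contDiffAt_snd (hα2 y hy)
    exact (h1.contMDiffAt.comp y (f := fun y => (‖β.1 y‖ ^ 2, ‖α.1 y‖ ^ 2))
      ((contMDiff_norm_sq hL β y).prodMk_space (contMDiff_norm_sq hL α y))).mdifferentiableAt
        (by simp)
  have hd : ∀ y ∈ {y | α.1 y ≠ 0}, mvfderiv I (fun y => ‖β.1 y‖ ^ 2 / ‖α.1 y‖ ^ 2) y = 0 := by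
    intro y hy
    ext v
    -- Differentiating (|β|²/|α|²)·|α|² = |β|² replaces the quotient rule; the two terms with Re ρ
    -- cancel.
    have hprod := mvfderiv_mul (hq y hy) ((contMDiff_norm_sq hL α).mdifferentiable (by simp) y)
    have hβ : β.1 y ≠ 0 := fun h => hy ((hz y).1 h)
    have hev : ((fun y => ‖β.1 y‖ ^ 2 / ‖α.1 y‖ ^ 2) * fun y => ‖α.1 y‖ ^ 2) =ᶠ[𝓝 y]
        fun y => ‖β.1 y‖ ^ 2 := by
      filter_upwards [hU.mem_nhds hy] with z hz'
      exact div_mul_cancel₀ _ (hα2 z hz')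
    have h1 := mvfderiv_congr hev v
    rw [hprod, mvfderiv_norm_sq hL ha hβ, hρ y hy] at h1
    simp only [add_apply, smul_apply, smul_eq_mul, mvfderiv_norm_sq hL ha hy] at h1
    have h2 := hα2 y hy
    have h3 : ‖α.1 y‖ ^ 2 * mvfderiv I (fun y => ‖β.1 y‖ ^ 2 / ‖α.1 y‖ ^ 2) y v = 0 := by
      have h4 : ‖β.1 y‖ ^ 2 / ‖α.1 y‖ ^ 2 * (2 * ‖α.1 y‖ ^ 2 * reRho a α y v) =
          2 * ‖β.1 y‖ ^ 2 * reRho a α y v := by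
        rw [mul_assoc, mul_left_comm, ← mul_assoc (_ / _), div_mul_cancel₀ _ h2, mul_assoc]
      rw [h4] at h1
      linarith
    exact (mul_eq_zero.1 h3).resolve_left h2
  filter_upwards [eventually_eq_of_mvfderiv_eq_zero hU hq hd hx] with y hy
  rw [← div_pow, ← div_pow] at hy
  exact (pow_left_inj₀ (by positivity) (by positivity) two_ne_zero).1 hy

theorem exists_eq_smul_near [I.Boundaryless] [CompleteSpace E] [ContMDiffVectorBundle ∞ ℂ L I]
    (hL : IsSmoothHermitian I L)
    (ha : IsHermitianConnection a) {α β : Γ I L} (hD : zeroDivisor β = zeroDivisor α)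
    (hρ : ∀ x, α.1 x ≠ 0 → reRho a β x = reRho a α x) (p : M) :
    ∃ V : Set M, IsOpen V ∧ p ∈ V ∧ ∃ w : M → ℂ, ContMDiffOn I 𝓘(ℝ, ℂ) ∞ w V ∧
      ∀ x ∈ V, w x ≠ 0 ∧ β.1 x = w x • α.1 x := by
  have hz : ∀ x, β.1 x = 0 ↔ α.1 x = 0 := fun x => by
    rw [← mem_divisorSupport_zeroDivisor, ← mem_divisorSupport_zeroDivisor, hD]
  set O := (trivializationAt ℂ L p).baseSet
  have hO : IsOpen O := (trivializationAt ℂ L p).open_baseSet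
  have hpO : p ∈ O := mem_baseSet_trivializationAt ℂ L p
  have h : SameZerosAt I p (localFn β p) (localFn α p) := by
    have := localFn_mem_zeroDivisor β p
    rw [hD] at this
    exact this
  rcases h with ⟨U, w, hU, hp, hw, h⟩ | ⟨U, hU, hp, hf, hg, h0, hfg0, -, hsurj, T, hT, hfg⟩
  · exact ⟨U ∩ O, hU.inter hO, ⟨hp, hpO⟩, w, hw.mono inter_subset_left, fun x hx =>
      ⟨(h x hx.1).1, eq_smul_of_localFn hx.2 (h x hx.1).2⟩⟩
  -- The trivialization is complex linear on fibers, so the modulus of the quotient of local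
  -- functions is the quotient of the hermitian norms.
  · have hnorm : ∀ x ∈ O, α.1 x ≠ 0 →
        ‖localFn β p x‖ / ‖localFn α p x‖ = ‖β.1 x‖ / ‖α.1 x‖ := by
      intro x hx hαx
      have h1 : localFn α p x ≠ 0 := fun h => hαx ((localFn_eq_zero_iff hx).1 h)
      have h2 : localFn β p x = localFn β p x / localFn α p x * localFn α p x :=
        (div_mul_cancel₀ _ h1).symm
      rw [eq_smul_of_localFn hx h2, norm_smul, norm_div,
        mul_div_cancel_right₀ _ (norm_ne_zero_iff.2 hαx)]
    obtain ⟨V, hV, hpV, hVU, w, hw, hwe⟩ := exists_eq_mul_of_mvfderiv_surjective (hU.inter hO)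
      ⟨hp, hpO⟩ (hf.mono inter_subset_left) (hg.mono inter_subset_left) ((hfg0 p hp).1 h0)
      (fun x hx => hfg0 x hx.1) hsurj hT hfg (fun x hx hgx => by
        have hαx : α.1 x ≠ 0 := fun h => hgx ((localFn_eq_zero_iff hx.2).2 h)
        have hcont := ((contMDiffOn_localFn α p).contMDiffAt (hO.mem_nhds hx.2)).continuousAt
        filter_upwards [eventually_norm_div_eq hL ha hz hρ hαx, hO.mem_nhds hx.2,
          hcont.eventually_ne hgx] with y hy hyO hgy
        rw [hnorm y hyO fun h => hgy ((localFn_eq_zero_iff hyO).2 h), hnorm x hx.2 hαx, hy])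
    exact ⟨V, hV, hpV, w, hw, fun x hx => ⟨(hwe x hx).1,
      eq_smul_of_localFn (hVU hx).2 (hwe x hx).2⟩⟩

/-- The local factors glue: off the zeros all of them equal β/α, and continuous functions that agree
on a dense set agree. -/
theorem exists_eq_smul [I.Boundaryless] [CompleteSpace E] [ContMDiffVectorBundle ∞ ℂ L I]
    (hL : IsSmoothHermitian I L)
    (ha : IsHermitianConnection a) {α β : Γ I L} (hD : zeroDivisor β = zeroDivisor α)
    (hρ : ∀ x, α.1 x ≠ 0 → reRho a β x = reRho a α x) (hd : Dense {x | α.1 x ≠ 0}) :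
    ∃ u : M → ℂ, ContMDiff I 𝓘(ℝ, ℂ) ∞ u ∧ ∀ x, u x ≠ 0 ∧ β.1 x = u x • α.1 x := by
  choose V hV hpV w hw hwe using exists_eq_smul_near hL ha hD hρ
  refine ⟨fun x => w x x, fun x => ?_, fun x => hwe x x (hpV x)⟩
  refine ((hw x).contMDiffAt ((hV x).mem_nhds (hpV x))).congr_of_eventuallyEq ?_
  filter_upwards [(hV x).mem_nhds (hpV x)] with y hy
  have : (𝓝[{x | α.1 x ≠ 0}] y).NeBot := mem_closure_iff_nhdsWithin_neBot.1 (hd y)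
  have c1 : ContinuousAt (w y) y := ((hw y).contMDiffAt ((hV y).mem_nhds (hpV y))).continuousAt
  have c2 : ContinuousAt (w x) y := ((hw x).contMDiffAt ((hV x).mem_nhds hy)).continuousAt
  have t1 : Filter.Tendsto (w y) (𝓝[{x | α.1 x ≠ 0}] y) (𝓝 (w y y)) :=
    c1.tendsto.mono_left nhdsWithin_le_nhds
  refine tendsto_nhds_unique_of_eventuallyEq t1 (c2.tendsto.mono_left nhdsWithin_le_nhds) ?_
  filter_upwards [self_mem_nhdsWithin, nhdsWithin_le_nhds ((hV y).mem_nhds (hpV y)),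
    nhdsWithin_le_nhds ((hV x).mem_nhds hy)] with z hz hzy hzx
  exact smul_left_injective ℂ hz ((hwe y z hzy).2.symm.trans (hwe x z hzx).2)

/-- Two sections with the same zero divisor and the same real part of `ρ`, whose zero set has empty
interior, differ by a constant factor and a phase change. -/
theorem exists_phase_of_zeroDivisor_eq [I.Boundaryless] [CompleteSpace E]
    [ContMDiffVectorBundle ∞ ℂ L I] [SimplyConnectedSpace M] [LocallyPathConnectedSpace M]
    (hL : IsSmoothHermitian I L)
    (ha : IsHermitianConnection a) {α β : Γ I L} (hD : zeroDivisor β = zeroDivisor α)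
    (hρ : ∀ x, α.1 x ≠ 0 → reRho a β x = reRho a α x) (hd : Dense {x | α.1 x ≠ 0}) :
    ∃ (c : ℂ) (F : C^∞⟮I, M; 𝓘(ℝ, ℝ), ℝ⟯), β = c • mulFn I (phaseFn I F) α := by
  obtain ⟨u, hu, hue⟩ := exists_eq_smul hL ha hD hρ hd
  have hz : ∀ x, β.1 x = 0 ↔ α.1 x = 0 := fun x => by
    rw [← mem_divisorSupport_zeroDivisor, ← mem_divisorSupport_zeroDivisor, hD]
  have hsm : ContMDiff I 𝓘(ℝ, ℝ) ∞ (fun x => ‖u x‖ ^ 2) :=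
    (contDiff_norm_sq ℝ (n := ∞)).contMDiff.comp hu
  have hUo : IsOpen {x | α.1 x ≠ 0} := by
    have : {y | α.1 y ≠ 0} = (fun y => ‖α.1 y‖ ^ 2) ⁻¹' {0}ᶜ := by ext y; simp
    rw [this]
    exact isOpen_compl_singleton.preimage (contMDiff_norm_sq hL α).continuous
  have hloc : ∀ x ∈ {x | α.1 x ≠ 0}, mvfderiv I (fun x => ‖u x‖ ^ 2) x = 0 := by
    intro x hx
    have hq : ∀ y, α.1 y ≠ 0 → ‖β.1 y‖ / ‖α.1 y‖ = ‖u y‖ := fun y hy => by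
      rw [(hue y).2, norm_smul, mul_div_cancel_right₀ _ (norm_ne_zero_iff.2 hy)]
    have hev : (fun x => ‖u x‖ ^ 2) =ᶠ[𝓝 x] fun _ => ‖u x‖ ^ 2 := by
      filter_upwards [eventually_norm_div_eq hL ha hz hρ hx, hUo.mem_nhds hx] with y hy hαy
      rw [hq y hαy, hq x hx] at hy
      rw [hy]
    ext v
    rw [mvfderiv_congr hev v, mvfderiv_const]
  -- The complement of the zeros may be disconnected, so local constancy there does not suffice. But
  -- |u|² is smooth on M, its differential vanishes everywhere by density, and M is connected.
  have hconst := eq_of_mvfderiv_eq_zero (hsm.mdifferentiable (by simp))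
    (mvfderiv_eq_zero_of_dense hsm hd hloc)
  obtain ⟨x₀⟩ : Nonempty M := inferInstance
  set c : ℝ := ‖u x₀‖
  have hc : 0 < c := norm_pos_iff.2 (hue x₀).1
  have hnorm : ∀ x, ‖u x‖ = c := fun x =>
    (pow_left_inj₀ (norm_nonneg _) (norm_nonneg _) two_ne_zero).1 (hconst x x₀)
  have hc' : (c : ℂ) ≠ 0 := Complex.ofReal_ne_zero.2 hc.ne'
  obtain ⟨F, hF⟩ := exists_phase (I := I) (u := fun x => (c : ℂ)⁻¹ * u x)
    ((contDiff_const.mul contDiff_id).contMDiff.comp hu) fun x => by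
      rw [norm_mul, norm_inv, Complex.norm_real, Real.norm_eq_abs, abs_of_pos hc, hnorm x,
        inv_mul_cancel₀ hc.ne']
  refine ⟨c, F, ?_⟩
  ext x
  have h1 : ((c : ℂ) • mulFn I (phaseFn I F) α).1 x =
      (c : ℂ) • Complex.exp (Complex.I * (F x : ℂ)) • α.1 x := rfl
  rw [h1, ← hF x, smul_smul, mul_inv_cancel_left₀ hc']
  exact (hue x).2

/-- Neither the divisor nor ρ sees a constant factor, so membership can be tested on any
representative. -/
theorem mem_PD0_iff (ha : IsHermitianConnection a) {D : M → Set (M → ℂ)}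
    [ContMDiffVectorBundle ∞ ℂ L I]
    {η : ∀ x : M, TangentSpace I x →L[ℝ] ℝ} {α : Γ I L} (hα : α ≠ 0) :
    Projectivization.mk ℂ α hα ∈ PD0 a D η ↔
      zeroDivisor α = D ∧ ∀ x, α.1 x ≠ 0 → reRho a α x = η x := by
  constructor
  · rintro ⟨⟨β, hβ, hαβ, rfl⟩, h⟩
    obtain ⟨c, hc⟩ := (Projectivization.mk_eq_mk_iff' ℂ _ _ hα hβ).1 hαβ
    have hc0 : c ≠ 0 := fun h0 => hα (by rw [← hc, h0, zero_smul])
    have hD : zeroDivisor α = zeroDivisor β :=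
      zeroDivisor_eq_of_smul (u := fun _ => c) contMDiff_const (fun _ => hc0) fun x => by
        rw [← hc]; rfl
    refine ⟨hD, fun x hx => h α hα rfl x ?_⟩
    rw [← hD, mem_divisorSupport_zeroDivisor]
    exact hx
  · rintro ⟨rfl, h⟩
    refine ⟨⟨α, hα, rfl, rfl⟩, fun β hβ hαβ x hx => ?_⟩
    rw [mem_divisorSupport_zeroDivisor] at hx
    obtain ⟨c, hc⟩ := (Projectivization.mk_eq_mk_iff' ℂ _ _ hβ hα).1 hαβ.symm
    have hc0 : c ≠ 0 := fun h0 => hβ (by rw [← hc, h0, zero_smul])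
    rw [← h x hx, ← hc, reRho, rho_const_smul ha hx hc0]
    rfl

theorem PD0_eq_phaseOrbit [I.Boundaryless] [CompleteSpace E]
    [ContMDiffVectorBundle ∞ ℂ L I] [SimplyConnectedSpace M] [LocallyPathConnectedSpace M]
    (hL : IsSmoothHermitian I L) (ha : IsHermitianConnection a) {D : M → Set (M → ℂ)}
    {η : ∀ x : M, TangentSpace I x →L[ℝ] ℝ} (hd : Dense (divisorSupport D)ᶜ) {p : PΓ I L}
    (hp : p ∈ PD0 a D η) : PD0 a D η = phaseOrbit p := by
  induction p using Projectivization.ind with | _ α hα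
  obtain ⟨rfl, hη⟩ := (mem_PD0_iff ha hα).1 hp
  rw [compl_divisorSupport_zeroDivisor] at hd
  have hz : ∀ β : Γ I L, zeroDivisor β = zeroDivisor α → ∀ x, β.1 x = 0 ↔ α.1 x = 0 :=
    fun β hβ x => by
      rw [← mem_divisorSupport_zeroDivisor, ← mem_divisorSupport_zeroDivisor, hβ]
  ext q
  constructor
  · intro hq
    induction q using Projectivization.ind with | _ β hβ
    obtain ⟨hD, hηβ⟩ := (mem_PD0_iff ha hβ).1 hq
    obtain ⟨c, F, hcF⟩ := exists_phase_of_zeroDivisor_eq hL ha hD (fun x hx => by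
      rw [hηβ x fun h => hx ((hz β hD x).1 h), hη x hx]) hd
    exact ⟨F, (mk_eq_of_smul (mulFn_phaseFn_ne_zero hα F) hβ hcF).symm⟩
  · rintro ⟨F, rfl⟩
    beta_reduce
    rw [P_mk, mem_PD0_iff ha]
    refine ⟨zeroDivisor_phase F α, fun x hx => ?_⟩
    have hx' : α.1 x ≠ 0 := fun h => hx ((hz _ (zeroDivisor_phase F α) x).2 h)
    rw [reRho_phase ha F α hx', hη x hx']

end Fibers

/-! ### The affine structure over the exact forms. -/

section Translations

variable {E : Type*} [NormedAddCommGroup E] [NormedSpace ℝ E]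
  {H : Type*} [TopologicalSpace H] {I : ModelWithCorners ℝ E H} [I.Boundaryless]
  {M : Type*} [TopologicalSpace M] [ChartedSpace H M] [IsManifold I ∞ M] [PreconnectedSpace M]
  {L : M → Type*} [∀ x, NormedAddCommGroup (L x)] [∀ x, InnerProductSpace ℂ (L x)]
  [TopologicalSpace (TotalSpace ℂ L)] [FiberBundle ℂ L]
  [VectorBundle ℂ ℂ L] [VectorBundle ℝ ℂ L]

theorem dFn_eq_iff {F G : C^∞⟮I, M; 𝓘(ℝ, ℝ), ℝ⟯} :
    dFn I M F = dFn I M G ↔ ∀ x y, F x - G x = F y - G y := by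
  have hd : ∀ x, mvfderiv I (F - G) x = dFn I M F x - dFn I M G x := fun x =>
    mvfderiv_sub (F.contMDiff.mdifferentiable (by simp) x) (G.contMDiff.mdifferentiable (by simp) x)
  constructor
  · intro h x y
    exact eq_of_mvfderiv_eq_zero (f := F - G) ((F - G).contMDiff.mdifferentiable (by simp))
      (fun z => by rw [hd, h, sub_self]) x y
  · intro h
    funext x
    have h1 : ⇑(F - G) = fun _ => F x - G x := funext fun y => h y x
    rw [← sub_eq_zero, ← hd, h1, mvfderiv_const]

/-- On the connected M the difference F - G is constant, and a constant phase is invisible in the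
projective space. -/
theorem P_eq_of_dFn_eq {F G : C^∞⟮I, M; 𝓘(ℝ, ℝ), ℝ⟯} (h : dFn I M F = dFn I M G) (p : PΓ I L) :
    P I F p = P I G p := by
  induction p using Projectivization.ind with | _ α hα
  obtain ⟨x₀, -⟩ := exists_ne_zero hα
  rw [P_mk, P_mk]
  refine mk_eq_of_smul _ _ (c := Complex.exp (Complex.I * ((F x₀ - G x₀ : ℝ) : ℂ))) ?_
  ext x
  have h1 : (Complex.exp (Complex.I * ((F x₀ - G x₀ : ℝ) : ℂ)) • mulFn I (phaseFn I G) α).1 x =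
      Complex.exp (Complex.I * ((F x₀ - G x₀ : ℝ) : ℂ)) •
        Complex.exp (Complex.I * (G x : ℂ)) • α.1 x := rfl
  rw [h1, mulFn_phaseFn_apply, smul_smul, ← Complex.exp_add, dFn_eq_iff.1 h x₀ x]
  congr 2
  push_cast
  ring

omit [I.Boundaryless] [IsManifold I ∞ M] [PreconnectedSpace M] in
/-- A phase factor that is constant on a dense set has an exponent with zero differential. -/
theorem dFn_eq_of_exp_eq {F G : C^∞⟮I, M; 𝓘(ℝ, ℝ), ℝ⟯} {S : Set M} (hS : Dense S) {c : ℂ}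
    (h : ∀ x ∈ S, Complex.exp (Complex.I * (F x : ℂ)) =
      c * Complex.exp (Complex.I * (G x : ℂ))) : dFn I M F = dFn I M G := by
  have hcF : Continuous F := F.contMDiff.continuous
  have hcG : Continuous G := G.contMDiff.continuous
  have hall : ∀ x, Complex.exp (Complex.I * ((F x - G x : ℝ) : ℂ)) = c := by
    have h1 : (fun x => Complex.exp (Complex.I * ((F x - G x : ℝ) : ℂ))) = fun _ => c := by
      refine Continuous.ext_on hS (by fun_prop) continuous_const fun x hx => ?_
      have h2 := h x hx
      rw [Complex.ofReal_sub, mul_sub, Complex.exp_sub, h2, mul_div_cancel_right₀ _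
        (Complex.exp_ne_zero _)]
    exact congrFun h1
  have hmd := (F - G).contMDiff.mdifferentiable (n := ∞) (by simp)
  funext x
  rw [← sub_eq_zero]
  have hd : mvfderiv I (F - G) x = dFn I M F x - dFn I M G x :=
    mvfderiv_sub (F.contMDiff.mdifferentiable (by simp) x) (G.contMDiff.mdifferentiable (by simp) x)
  rw [← hd]
  ext v
  have hφ : HasDerivAt (fun s : ℝ => Complex.exp (Complex.I * (s : ℂ)))
      (Complex.exp (Complex.I * (((F - G) x : ℝ) : ℂ)) * Complex.I) ((F - G) x) := by
    have := ((hasDerivAt_id ((F - G) x)).ofReal_comp.const_mul Complex.I).cexp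
    simpa using this
  have h2 := mvfderiv_comp_left (I := I) (F := ⇑(F - G)) (x := x) hφ.differentiableAt (hmd x) v
  have h3 : (fun y => Complex.exp (Complex.I * (((F - G) y : ℝ) : ℂ))) = fun _ => c := funext hall
  rw [h3, mvfderiv_const, hφ.hasFDerivAt.fderiv] at h2
  have h4 : (mvfderiv I (F - G) x v) •
      (Complex.exp (Complex.I * (((F - G) x : ℝ) : ℂ)) * Complex.I) = 0 := h2.symm
  exact (smul_eq_zero.1 h4).resolve_right
    (mul_ne_zero (Complex.exp_ne_zero _) Complex.I_ne_zero)

omit [I.Boundaryless] [IsManifold I ∞ M] [PreconnectedSpace M] in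
theorem dFn_eq_of_P_eq {F G : C^∞⟮I, M; 𝓘(ℝ, ℝ), ℝ⟯} {α : Γ I L} (hα : α ≠ 0)
    (hd : Dense {x | α.1 x ≠ 0})
    (h : P I F (Projectivization.mk ℂ α hα) = P I G (Projectivization.mk ℂ α hα)) :
    dFn I M F = dFn I M G := by
  rw [P_mk, P_mk] at h
  obtain ⟨c, hc⟩ := (Projectivization.mk_eq_mk_iff' ℂ _ _ _ _).1 h
  refine dFn_eq_of_exp_eq hd (c := c) fun x hx => smul_left_injective ℂ hx ?_
  have h1 : c • Complex.exp (Complex.I * (G x : ℂ)) • α.1 x =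
    Complex.exp (Complex.I * (F x : ℂ)) • α.1 x := congrFun (congrArg Subtype.val hc) x
  beta_reduce
  rw [← h1, smul_smul]

/-- Equality means that i(F - G)α is a complex multiple of α; then F - G is constant off the zeros
and, by density, on M. -/
theorem ΘP_eq_iff {F G : C^∞⟮I, M; 𝓘(ℝ, ℝ), ℝ⟯} {α : Γ I L} (hα : α ≠ 0)
    (hd : Dense {x | α.1 x ≠ 0}) :
    ΘP I F (Projectivization.mk ℂ α hα) = ΘP I G (Projectivization.mk ℂ α hα) ↔
      dFn I M F = dFn I M G := by
  have hmem : α ∈ (Projectivization.mk ℂ α hα).submodule :=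
    (mem_submodule_iff hα).2 ⟨1, (one_smul _ _).symm⟩
  have hval : ∀ x, (mulFn I (iFn I F) α - mulFn I (iFn I G) α).1 x =
      (Complex.I * ((F x - G x : ℝ) : ℂ)) • α.1 x := fun x => by
    change (Complex.I * (F x : ℂ)) • α.1 x - (Complex.I * (G x : ℂ)) • α.1 x = _
    rw [← sub_smul]; push_cast; ring_nf
  constructor
  · intro h
    have h1 := congrArg (fun ξ => ξ ⟨α, hmem⟩) h
    obtain ⟨c, hc⟩ := (mem_submodule_iff hα).1 ((Submodule.Quotient.eq _).1 h1)
    have hon : ∀ x ∈ {x | α.1 x ≠ 0}, Complex.I * ((F x - G x : ℝ) : ℂ) = c := fun x hx => by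
      refine smul_left_injective ℂ hx ?_
      exact (hval x).symm.trans (congrFun (congrArg Subtype.val hc) x)
    have hcF : Continuous F := F.contMDiff.continuous
    have hcG : Continuous G := G.contMDiff.continuous
    have hall : (fun x => Complex.I * ((F x - G x : ℝ) : ℂ)) = fun _ => c :=
      Continuous.ext_on hd (by fun_prop) continuous_const hon
    rw [dFn_eq_iff]
    intro x y
    have h2 := (congrFun hall x).trans (congrFun hall y).symm
    exact Complex.ofReal_injective (mul_left_cancel₀ Complex.I_ne_zero h2)
  · intro h
    obtain ⟨x₀, -⟩ := exists_ne_zero hα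
    refine tangent_ext rfl fun v hv => (Submodule.Quotient.eq _).2 ?_
    change mulFn I (iFn I F) (v : Γ I L) - mulFn I (iFn I G) (v : Γ I L) ∈ _
    rw [hv]
    refine (mem_submodule_iff hα).2 ⟨Complex.I * ((F x₀ - G x₀ : ℝ) : ℂ), ?_⟩
    ext x
    rw [hval x, dFn_eq_iff.1 h x x₀]
    rfl

/-- An exact form acts through any of its primitives, since these differ by constants. Transitivity
is built into the orbit; uniqueness of the translation comes from the density of the complement of
the zeros. -/
theorem isAffineOverExactForms_phaseOrbit {α : Γ I L} (hα : α ≠ 0) (hd : Dense {x | α.1 x ≠ 0}) :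
    IsAffineOverExactForms (phaseOrbit (Projectivization.mk ℂ α hα)) := by
  set p := Projectivization.mk ℂ α hα
  have hP : ∀ (F : C^∞⟮I, M; 𝓘(ℝ, ℝ), ℝ⟯) (q : phaseOrbit p), P I F (q : PΓ I L) ∈ phaseOrbit p := by
    rintro F ⟨_, G, rfl⟩
    exact ⟨F + G, P_add F G p⟩
  have hinj : ∀ (F G : C^∞⟮I, M; 𝓘(ℝ, ℝ), ℝ⟯) (q : phaseOrbit p), P I F (q : PΓ I L) = P I G q →
      dFn I M F = dFn I M G := by
    rintro F G ⟨_, K, rfl⟩ h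
    rw [← P_add, ← P_add] at h
    have h1 := dFn_eq_of_P_eq hα hd h
    rwa [map_add, map_add, add_left_inj] at h1
  have hex : ∀ q r : phaseOrbit p, ∃ F : C^∞⟮I, M; 𝓘(ℝ, ℝ), ℝ⟯, P I F (r : PΓ I L) = (q : PΓ I L) := by
    rintro ⟨_, F, rfl⟩ ⟨_, G, rfl⟩
    exact ⟨F - G, by beta_reduce; rw [← P_add, sub_add_cancel]⟩
  choose diff hdiff using hex
  have hprim : ∀ θ : ExactForms I M, ∃ F : C^∞⟮I, M; 𝓘(ℝ, ℝ), ℝ⟯, dFn I M F = θ := fun θ => θ.2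
  choose prim hprim using hprim
  have hzero : dFn I M (prim 0) = dFn I M 0 := by rw [hprim, map_zero]; rfl
  have hadd : ∀ θ ψ, dFn I M (prim (θ + ψ)) = dFn I M (prim θ + prim ψ) := fun θ ψ => by
    rw [map_add, hprim, hprim, hprim]; rfl
  exact ⟨{ vadd := fun θ q => ⟨P I (prim θ) q, hP _ q⟩
           zero_vadd := fun q => Subtype.ext ((P_eq_of_dFn_eq hzero _).trans (P_zero _))
           add_vadd := fun θ ψ q => Subtype.ext ((P_eq_of_dFn_eq (hadd θ ψ) _).trans (P_add _ _ _))
           vsub := fun q r => ⟨dFn I M (diff q r), LinearMap.mem_range_self _ _⟩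
           nonempty := ⟨⟨p, self_mem_phaseOrbit p⟩⟩
           vsub_vadd' := fun q r => Subtype.ext ((P_eq_of_dFn_eq (hprim _) _).trans (hdiff q r))
           vadd_vsub' := fun θ q => Subtype.ext ((hinj _ _ q (hdiff _ q)).trans (hprim θ)) },
    fun F q => P_eq_of_dFn_eq (hprim _) _⟩

end Translations

end PhaseChange

theorem proposition3 {n : ℕ} {M : Type*} [TopologicalSpace M]
    [ChartedSpace (EuclideanSpace ℝ (Fin (2 * n))) M] [IsManifold (𝓡 (2 * n)) ∞ M]
    [T2Space M] [CompactSpace M] [SimplyConnectedSpace M]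
    (Ω : SymplecticForm (𝓡 (2 * n)) M)
    {L : M → Type*} [∀ x, NormedAddCommGroup (L x)] [∀ x, InnerProductSpace ℂ (L x)]
    [TopologicalSpace (TotalSpace ℂ L)] [FiberBundle ℂ L] [VectorBundle ℂ ℂ L]
    [VectorBundle ℝ ℂ L] [ContMDiffVectorBundle ∞ ℂ L (𝓡 (2 * n))]
    (hL : IsSmoothHermitian (𝓡 (2 * n)) L)
    (a : CovariantDerivative (𝓡 (2 * n)) ℂ L) (ha : IsPrequantumConnection Ω a) :
    -- `Θ_P(F)` is the vector field generated by the one-parameter group `P(tF)`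
    (∀ (F : C^∞⟮𝓡 (2 * n), M; 𝓘(ℝ, ℝ), ℝ⟯) (p : PΓ (𝓡 (2 * n)) L) (t : ℝ),
      HasVelocity (fun s : ℝ => P (𝓡 (2 * n)) (s • F) p) t (P (𝓡 (2 * n)) (t • F) p)
        (ΘP (𝓡 (2 * n)) F (P (𝓡 (2 * n)) (t • F) p))) ∧
    -- the distribution is integrable: every point lies on a leaf
    (∀ p : PΓ (𝓡 (2 * n)) L, ∃ N, p ∈ N ∧ IsLeaf N) ∧
    -- the nonempty fibers `ℙ⁰(D)` are leaves
    (∀ (D : M → Set (M → ℂ)) (η : ∀ x : M, TangentSpace (𝓡 (2 * n)) x →L[ℝ] ℝ),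
      Dense (divisorSupport D)ᶜ → (PD0 a D η).Nonempty → IsLeaf (PD0 a D η)) ∧
    -- the leaf of a section with nowhere dense zero set is a fiber `ℙ⁰(D)`, its own one
    (∀ (N : Set (PΓ (𝓡 (2 * n)) L)) (α : Γ (𝓡 (2 * n)) L) (hα : α ≠ 0),
      IsLeaf N → Dense {x | α.1 x ≠ 0} → Projectivization.mk ℂ α hα ∈ N →
        N = PD0 a (zeroDivisor α) (reRho a α)) ∧
    -- `ρ(P(F) α) = ρ(α) + i dF`
    (∀ (F : C^∞⟮𝓡 (2 * n), M; 𝓘(ℝ, ℝ), ℝ⟯) (α : Γ (𝓡 (2 * n)) L) (x : M)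
      (v : TangentSpace (𝓡 (2 * n)) x), α.1 x ≠ 0 →
        rho a (mulFn (𝓡 (2 * n)) (phaseFn (𝓡 (2 * n)) F) α) x v
          = rho a α x v + Complex.I * ((dFn (𝓡 (2 * n)) M F x v : ℝ) : ℂ)) ∧
    -- every nonempty fiber `ℙ⁰(D)` is a real affine space over the exact real one-forms on `M`
    (∀ (D : M → Set (M → ℂ)) (η : ∀ x : M, TangentSpace (𝓡 (2 * n)) x →L[ℝ] ℝ),
      Dense (divisorSupport D)ᶜ → (PD0 a D η).Nonempty →
        IsAffineOverExactForms (PD0 a D η) ∧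
        ∀ p ∈ PD0 a D η, ∀ F G : C^∞⟮𝓡 (2 * n), M; 𝓘(ℝ, ℝ), ℝ⟯,
          ΘP (𝓡 (2 * n)) F p = ΘP (𝓡 (2 * n)) G p ↔
            dFn (𝓡 (2 * n)) M F = dFn (𝓡 (2 * n)) M G) := by
  have hc := ha.toIsHermitianConnection
  -- Local path connectedness enters the lifting through exp; it is inherited from the charts.
  have : LocallyPathConnectedSpace M :=
    ChartedSpace.locallyPathConnectedSpace (EuclideanSpace ℝ (Fin (2 * n))) M
  refine ⟨hasVelocity_smul, fun p => ⟨phaseOrbit p, self_mem_phaseOrbit p, isLeaf_phaseOrbit p⟩,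
    fun D η hd hN => ?_, fun N α hα hN hd hmem => ?_, fun F α x v hx => rho_phase hc F α hx v,
    fun D η hd hN => ?_⟩
  · obtain ⟨p, hp⟩ := hN
    rw [PD0_eq_phaseOrbit hL hc hd hp]
    exact isLeaf_phaseOrbit p
  · rw [hN.eq_phaseOrbit hmem, PD0_eq_phaseOrbit hL hc
      (by rwa [compl_divisorSupport_zeroDivisor])
      ((mem_PD0_iff hc hα).2 ⟨rfl, fun _ _ => rfl⟩)]
  · have hrep : ∀ p ∈ PD0 a D η, ∃ (α : Γ (𝓡 (2 * n)) L) (hα : α ≠ 0),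
        p = Projectivization.mk ℂ α hα ∧ Dense {x | α.1 x ≠ 0} := by
      rintro p ⟨⟨α, hα, rfl, rfl⟩, -⟩
      exact ⟨α, hα, rfl, by rwa [compl_divisorSupport_zeroDivisor] at hd⟩
    refine ⟨?_, fun p hp F G => ?_⟩
    · obtain ⟨p, hp⟩ := hN
      obtain ⟨α, hα, rfl, hdα⟩ := hrep p hp
      rw [PD0_eq_phaseOrbit hL hc hd hp]
      exact isAffineOverExactForms_phaseOrbit hα hdα
    · obtain ⟨α, hα, rfl, hdα⟩ := hrep p hp
      exact ΘP_eq_iff hα hdα
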